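/- All matroids are finite; \(r_M\) is the rank function of \(M\), and \(\lambda_M(X)=r_M(X)+r_M(E(M)-X)-r(M)\). A set \(X\) is exactly \(k\)-separating if \(\lambda_M(X)=k-1\). **Definitions.** Let \(\sigma=(e_1,\dots,e_n)\) be a cyclic ordering of \(E(M)\), with subscripts modulo \(n\), and let \(t\ge 1\), \(n\ge t+1\). Then \(\sigma\) is a *\(t\)-cyclic ordering* of \(M\) (and \(M\) is *\(t\)-cyclic*) if, for all odd \(i\in\{1,\dots,n\}\), either (i) \(\{e_i,\dots,e_{i+t-1}\}\) is a \(t\)-element circuit and \(\{e_{i+1},\dots,e_{i+t}\}\) is a \(t\)-element cocircuit, or (ii) \(\{e_i,\dots,e_{i+t-1}\}\) is both a \(t\)-element circuit and a \(t\)-element cocircuit. It is *odd* if (i) holds for all odd \(i\), and *even* if (ii) holds for all odd \(i\). A *concatenation* of \(\sigma\) is a partition \((P_1,\dots,P_m)\) of \(E(M)\) into nonempty sets of cyclically consecutive elements, listed in cyclic order. It is *even* (with respect to \(t\)) if every petal \(P_i=\{e_{j+1},\dots,e_{j+k}\}\) has \(|P_i|\ge t-2\), \(|P_i|\) even and \(j+1\)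 odd. A partition \(\Phi=(P_1,\dots,P_m)\) of \(E(M)\) into nonempty sets is a *\(k\)-flower* if each \(P_i\) is exactly \(k\)-separating (when \(m\ge 2\)) and each \(P_i\cup P_{i+1}\) is exactly \(k\)-separating (when \(m\ge 3\)), indices modulo \(m\); for \(m=1\) it is a \(k\)-flower by convention. A \(k\)-flower is a *\(k\)-anemone* if \(\bigcup_{i\in I}P_i\) is exactly \(k\)-separating for all nonempty proper \(I\subset\{1,\dots,m\}\), and a *\(k\)-daisy* if, for nonempty proper \(I\), this union is exactly \(k\)-separating precisely when \(I\) is consecutive in the cyclic order \((1,\dots,m)\). A *rank-\(r\) spike* (\(r\ge3\)) is a matroid whose ground set is partitioned into pairs \(L_1,\dots,L_r\) such that \(L_i\cup L_j\) is a 4-element circuit and a 4-element cocircuit for all \(i\ne j\). A *rank-\(r\) swirl* (\(r\ge3\)) is obtained from a simple matroid whose ground set is the disjoint union of a basis \(B=\{b_1,\dots,b_r\}\) and pairs \(L_1,\dots,L_r\) with \(L_i\subseteq \mathrm{cl}(\{b_i,b_{i+1}\})\) (indices modulo \(r\)) by deleting \(B\). The *truncation* of \(M\) is obtained by freely adding an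 element and contracting it; the *Higgs lift* of \(M\) is obtained by freely coextending by an element (dually to free extension) and deleting it. Let \(T(M)\) be the Higgs lift of the truncation of \(M\). **Theorem.** 1. Let \(t\ge2\) and let \(\sigma\) be a \(t\)-cyclic ordering of a matroid \(M\) with \(|E(M)|\ge 2t+2\). Then \(N=T(M)\) has ground set \(E(M)\), and \(\sigma\) is a \((t+2)\)-cyclic ordering of \(N\); if \(\sigma\) is odd (respectively, even) for \(M\), then it is odd (respectively, even) for \(N\). 2. In (1), suppose moreover that \(t\) is even, and let \(\Phi=(P_1,\dots,P_m)\) be an even concatenation of \(\sigma\) with \(|P_i|\ge t\) for all \(i\). Then \(\Phi\) is a \((t-1)\)-flower of \(M\) and a \((t+1)\)-flower of \(N\). If \(m\ge4\), then \(r_N(P_i)=r_M(P_i)+1\) and \(r_N(P_i\cup P_j)=r_M(P_i\cup P_j)+1\) for all \(i,j\). If \(\Phi\) is a \((t-1)\)-anemone of \(M\), then it is a \((t+1)\)-anemone of \(N\); if it is a \((t-1)\)-daisy of \(M\), then it is a \((t+1)\)-daisy of \(N\). 3. Let \(M\) be a rank-\(r\) spike with pairs \(L_1,\dots,L_r\),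 and let \(\sigma=(e_1,\dots,e_{2r})\) be a cyclic ordering of \(E(M)\) such that the sets \(\{e_{2i-1},e_{2i}\}\) are the pairs \(L_1,\dots,L_r\) in some order. Then, for all \(k\ge0\) with \(r\ge2k+3\), \(\sigma\) is an even \((2k+4)\)-cyclic ordering of \(T^k(M)\), and every even concatenation of \(\sigma\) (with respect to \(2k+4\)) is a \((2k+3)\)-anemone of \(T^k(M)\). 4. Let \(M\) be a rank-\(r\) swirl with pairs \(L_1,\dots,L_r\), and let \(\sigma=(e_1,\dots,e_{2r})\) be a cyclic ordering of \(E(M)\) with \(L_i=\{e_{2i-1},e_{2i}\}\) for all \(i\). Then, for all \(k\ge0\) with \(r\ge2k+3\), \(\sigma\) is an even \((2k+4)\)-cyclic ordering of \(T^k(M)\), and every even concatenation of \(\sigma\) (with respect to \(2k+4\)) is a \((2k+3)\)-daisy of \(T^k(M)\). 5. Hence, for every even \(t\ge4\) and every \(r\ge t-1\), there is a \(t\)-cyclic matroid on \(2r\) elements, with an even \(t\)-cyclic ordering all of whose even concatenations are \((t-1)\)-anemones; and there is a \(t\)-cyclic matroid on \(2r\) elements, with an even \(t\)-cyclic ordering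 all of whose even concatenations are \((t-1)\)-daisies. -/

import Mathlib

open Set

namespace CyclicMatroid

/-! ### Free extension, truncation, free coextension, Higgs lift -/

/-- The independent sets of the matroid obtained from `M` by freely adding the element `none`:
the independent sets of `M`, and the sets `I ∪ {none}` for independent non-bases `I` of `M`. -/
def FreeExtIndep {α : Type*} (M : Matroid α) (J : Set (Option α)) : Prop :=
  M.Indep (some ⁻¹' J) ∧ (none ∈ J → ¬ M.IsBase (some ⁻¹' J))

theorem freeExtIndep_subset {α : Type*} {M : Matroid α} {I J : Set (Option α)}
    (hJ : FreeExtIndep M J) (hIJ : I ⊆ J) : FreeExtIndep M I := by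
  refine ⟨hJ.1.subset (preimage_mono hIJ), fun hn hb ↦ hJ.2 (hIJ hn) ?_⟩
  rwa [← hb.eq_of_subset_indep hJ.1 (preimage_mono hIJ)]

theorem preimage_insert_some {α : Type*} (x : α) (I : Set (Option α)) :
    some ⁻¹' (insert (some x) I) = insert x (some ⁻¹' I) := by
  ext; simp

theorem preimage_insert_none {α : Type*} (I : Set (Option α)) :
    (some ⁻¹' (insert none I) : Set α) = some ⁻¹' I := by
  ext; simp

theorem preimage_some_image {α : Type*} (K : Set α) :
    some ⁻¹' (some '' K) = K := preimage_image_eq _ (Option.some_injective α)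

theorem freeExtIndep_aug {α : Type*} {M : Matroid α} {I B : Set (Option α)}
    (hI : FreeExtIndep M I) (hImax : ¬ Maximal (FreeExtIndep M) I)
    (hB : Maximal (FreeExtIndep M) B) : ∃ x ∈ B \ I, FreeExtIndep M (insert x I) := by
  obtain ⟨I', hssub, hI'⟩ := (not_maximal_subset_iff hI).1 hImax
  have hsub := preimage_mono (f := (some : α → Option α)) hssub.subset
  have hnb : ¬ M.IsBase (some ⁻¹' I) := by
    intro hb
    have heq := hb.eq_of_subset_indep hI'.1 hsub
    obtain ⟨x, hx, hxI⟩ := exists_of_ssubset hssub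
    cases x with
    | none => exact hI'.2 hx (heq ▸ hb)
    | some x =>
      have : x ∈ (some ⁻¹' I : Set α) := by rw [heq]; exact hx
      exact hxI this
  by_cases hn : none ∈ I
  · obtain ⟨x, hx, hxI⟩ := exists_of_ssubset hssub
    obtain ⟨y, rfl⟩ : ∃ y, x = some y := by
      cases x with
      | none => exact absurd hn hxI
      | some y => exact ⟨y, rfl⟩
    have hyI := freeExtIndep_subset hI' (insert_subset hx hssub.subset)
    have hyb := hyI.2 (mem_insert_of_mem _ hn)
    have hyi := hyI.1
    rw [preimage_insert_some] at hyb hyi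
    have key : ∀ z, z ∉ (some ⁻¹' I : Set α) → ¬ M.IsBase (insert z (some ⁻¹' I)) :=
      fun z hz hb ↦ hyb (Matroid.insert_isBase_of_insert_indep hz hxI hb hyi)
    suffices h : ∃ z ∈ (some ⁻¹' B : Set α) \ (some ⁻¹' I), M.Indep (insert z (some ⁻¹' I)) by
      obtain ⟨z, hz, hzi⟩ := h
      refine ⟨some z, hz, ?_, fun _ ↦ ?_⟩ <;> rw [preimage_insert_some]
      exacts [hzi, key z hz.2]
    obtain ⟨C, hC, hBC⟩ := hB.prop.1.exists_isBase_superset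
    obtain ⟨z, hz, hzi⟩ := hI.1.exists_insert_of_not_isBase hnb hC
    by_cases hzB : some z ∈ B
    · exact ⟨z, ⟨hzB, hz.2⟩, hzi⟩
    obtain ⟨w, hw, hwi⟩ := hzi.exists_insert_of_not_isBase (key z hz.2) hC
    have hwz : w ≠ z := fun h ↦ hw.2 (by simp [h])
    have hwI : w ∉ (some ⁻¹' I : Set α) := fun h ↦ hw.2 (mem_insert_of_mem _ h)
    by_cases hwB : some w ∈ B
    · exact ⟨w, ⟨hwB, hwI⟩, hwi.subset (insert_subset_insert (subset_insert _ _))⟩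
    have hins : FreeExtIndep M (insert (some z) B) := by
      constructor
      · rw [preimage_insert_some]
        exact hC.indep.subset (insert_subset hz.1 hBC)
      · rw [preimage_insert_some]
        intro _ hb
        have := hb.eq_of_subset_isBase hC (insert_subset hz.1 hBC)
        have hw' : w ∈ insert z (some ⁻¹' B : Set α) := this ▸ hw.1
        rcases hw' with h | h
        exacts [hwz h, hwB h]
    exact absurd (hB.le_of_ge hins (subset_insert _ _) (mem_insert _ _)) hzB
  by_cases hnB : none ∈ B
  · refine ⟨none, ⟨hnB, hn⟩, ?_, fun _ ↦ ?_⟩ <;> rw [preimage_insert_none]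
    exacts [hI.1, hnb]
  have hBb : M.IsBase (some ⁻¹' B) := by
    by_contra hb
    have hins : FreeExtIndep M (insert none B) := by
      refine ⟨?_, fun _ ↦ ?_⟩ <;> rw [preimage_insert_none]
      exacts [hB.prop.1, hb]
    exact hnB (hB.le_of_ge hins (subset_insert _ _) (mem_insert _ _))
  obtain ⟨z, hz, hzi⟩ := hI.1.exists_insert_of_not_isBase hnb hBb
  refine ⟨some z, hz, ?_, fun h ↦ absurd h (by simpa using hn)⟩
  rwa [preimage_insert_some]

theorem freeExtIndep_maximal {α : Type*} {M : Matroid α} (X : Set (Option α))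
    (hX : X ⊆ insert none (some '' M.E)) :
    Matroid.ExistsMaximalSubsetProperty (FreeExtIndep M) X := by
  intro I hI hIX
  have hXE : (some ⁻¹' X : Set α) ⊆ M.E := fun x hx ↦ by simpa using hX hx
  obtain ⟨K, hK, hIK⟩ := hI.1.subset_isBasis_of_subset (preimage_mono hIX) hXE
  have hKX : some '' K ⊆ X := image_subset_iff.2 hK.subset
  have hle : ∀ J : Set (Option α), FreeExtIndep M J → J ⊆ X → K ⊆ some ⁻¹' J →
      some ⁻¹' J = K := fun J hJ hJX hKJ ↦
    (hK.eq_of_subset_indep hJ.1 hKJ (preimage_mono hJX)).symm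
  by_cases hnX : none ∈ X ∧ ¬ M.IsBase K
  · refine ⟨insert none (some '' K), ?_, ⟨⟨?_, fun _ ↦ ?_⟩, insert_subset hnX.1 hKX⟩, ?_⟩
    · rintro (_ | x) hx
      · exact mem_insert _ _
      · exact mem_insert_of_mem _ ⟨x, hIK hx, rfl⟩
    · rw [preimage_insert_none, preimage_some_image]; exact hK.indep
    · rw [preimage_insert_none, preimage_some_image]; exact hnX.2
    · rintro J ⟨hJ, hJX⟩ hle'
      have h := hle J hJ hJX (fun x hx ↦ hle' (mem_insert_of_mem _ ⟨x, hx, rfl⟩))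
      rintro (_ | x) hx
      · exact mem_insert _ _
      · exact mem_insert_of_mem _ ⟨x, h ▸ hx, rfl⟩
  by_cases hnI : none ∈ I
  · have hKb : M.IsBase K := by
      by_contra h
      exact hnX ⟨hIX hnI, h⟩
    have hne : some ⁻¹' I ≠ K := by
      rintro h
      exact hI.2 hnI (h ▸ hKb)
    obtain ⟨k, hk, hkI⟩ := exists_of_ssubset (hIK.ssubset_of_ne hne)
    refine ⟨insert none (some '' (K \ {k})), ?_, ⟨⟨?_, fun _ ↦ ?_⟩,
      insert_subset (hIX hnI) ((image_mono sdiff_subset).trans hKX)⟩, ?_⟩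
    · rintro (_ | x) hx
      · exact mem_insert _ _
      · exact mem_insert_of_mem _ ⟨x, ⟨hIK hx, fun h ↦ hkI (h ▸ hx)⟩, rfl⟩
    · rw [preimage_insert_none, preimage_some_image]; exact hK.indep.subset sdiff_subset
    · rw [preimage_insert_none, preimage_some_image]
      intro hb
      exact (hb.eq_of_subset_isBase hKb sdiff_subset ▸ hk).2 rfl
    · rintro J ⟨hJ, hJX⟩ hle'
      have hnJ : none ∈ J := hle' (mem_insert _ _)
      rintro (_ | x) hx
      · exact mem_insert _ _
      by_contra hxn
      have hxK : x ∉ K \ {k} := fun h ↦ hxn (mem_insert_of_mem _ ⟨x, h, rfl⟩)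
      have hsub : insert x (K \ {k}) ⊆ some ⁻¹' J :=
        insert_subset hx (fun y hy ↦ hle' (mem_insert_of_mem _ ⟨y, hy, rfl⟩))
      have hb : M.IsBase (insert x (K \ {k})) :=
        Matroid.insert_isBase_of_insert_indep (e := k) (by simp) hxK
          (by rwa [insert_sdiff_singleton, insert_eq_of_mem hk]) (hJ.1.subset hsub)
      exact hJ.2 hnJ (hb.eq_of_subset_indep hJ.1 hsub ▸ hb)
  refine ⟨some '' K, ?_, ⟨⟨?_, fun h ↦ by simp at h⟩, hKX⟩, ?_⟩
  · rintro (_ | x) hx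
    · exact absurd hx hnI
    · exact ⟨x, hIK hx, rfl⟩
  · rw [preimage_some_image]; exact hK.indep
  · rintro J ⟨hJ, hJX⟩ hle'
    have h := hle J hJ hJX (fun x hx ↦ hle' ⟨x, hx, rfl⟩)
    rintro (_ | x) hx
    · exact absurd ⟨hJX hx, h ▸ hJ.2 hx⟩ hnX
    · exact ⟨x, h ▸ hx, rfl⟩

/-- The free (single-element) extension of `M` by the new element `none`. -/
def freeExtension {α : Type*} (M : Matroid α) : Matroid (Option α) :=
  IndepMatroid.matroid
    { E := insert none (some '' M.E)
      Indep := FreeExtIndep M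
      indep_empty := ⟨by simp, fun h ↦ by simp at h⟩
      indep_subset := fun _ _ ↦ freeExtIndep_subset
      indep_aug := fun _ _ ↦ freeExtIndep_aug
      indep_maximal := freeExtIndep_maximal
      subset_ground := by
        rintro I hI (_ | x) hx
        · exact mem_insert _ _
        · exact mem_insert_of_mem _ ⟨x, hI.1.subset_ground hx, rfl⟩ }

/-- The truncation of `M`: freely add an element to `M`, then contract it. -/
def truncation {α : Type*} (M : Matroid α) : Matroid α :=
  ((freeExtension M).contract {none}).comap some

/-- The free coextension of `M` by the new element `none`: the dual of the free extension of the
dual of `M`. -/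
def freeCoextension {α : Type*} (M : Matroid α) : Matroid (Option α) :=
  (freeExtension M.dual).dual

/-- The Higgs lift of `M`: freely coextend `M` by an element, then delete it. -/
def higgsLift {α : Type*} (M : Matroid α) : Matroid α :=
  ((freeCoextension M).delete {none}).comap some

/-- Truncation followed by the Higgs lift. -/
def truncLift {α : Type*} (M : Matroid α) : Matroid α :=
  higgsLift (truncation M)

/-! ### Cyclic orderings and `t`-cyclic matroids -/

/-- `σ = (e_1, …, e_n)` is a cyclic ordering of the set `E`, where `e_j = σ j` and all subscripts
are read modulo `n`. -/
def IsCyclicOrdering {α : Type*} {n : ℕ} (σ : ZMod n → α) (E : Set α) : Prop :=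
  0 < n ∧ Function.Injective σ ∧ range σ = E

/-- The set `{e_i, e_{i+1}, …, e_{i+k-1}}`. -/
def window {α : Type*} {n : ℕ} (σ : ZMod n → α) (i k : ℕ) : Set α :=
  (fun j : ℕ => σ (j : ZMod n)) '' Ico i (i + k)

def IsCircuitOfSize {α : Type*} (M : Matroid α) (t : ℕ) (C : Set α) : Prop :=
  M.IsCircuit C ∧ C.ncard = t

def IsCocircuitOfSize {α : Type*} (M : Matroid α) (t : ℕ) (C : Set α) : Prop :=
  M.IsCocircuit C ∧ C.ncard = t

/-- The first alternative in the definition of a `t`-cyclic ordering, at the index `i`. -/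
def OddAt {α : Type*} (t : ℕ) (M : Matroid α) {n : ℕ} (σ : ZMod n → α) (i : ℕ) : Prop :=
  IsCircuitOfSize M t (window σ i t) ∧ IsCocircuitOfSize M t (window σ (i + 1) t)

/-- The second alternative in the definition of a `t`-cyclic ordering, at the index `i`. -/
def EvenAt {α : Type*} (t : ℕ) (M : Matroid α) {n : ℕ} (σ : ZMod n → α) (i : ℕ) : Prop :=
  IsCircuitOfSize M t (window σ i t) ∧ IsCocircuitOfSize M t (window σ i t)

/-- `σ` is a `t`-cyclic ordering of `M`. -/
def IsTCyclicOrdering {α : Type*} (t : ℕ) (M : Matroid α) {n : ℕ} (σ : ZMod n → α) : Prop :=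
  IsCyclicOrdering σ M.E ∧ 1 ≤ t ∧ t + 1 ≤ n ∧
    ∀ i, 1 ≤ i → i ≤ n → Odd i → OddAt t M σ i ∨ EvenAt t M σ i

/-- `σ` is an odd `t`-cyclic ordering of `M`. -/
def IsOddTCyclicOrdering {α : Type*} (t : ℕ) (M : Matroid α) {n : ℕ} (σ : ZMod n → α) : Prop :=
  IsTCyclicOrdering t M σ ∧ ∀ i, 1 ≤ i → i ≤ n → Odd i → OddAt t M σ i

/-- `σ` is an even `t`-cyclic ordering of `M`. -/
def IsEvenTCyclicOrdering {α : Type*} (t : ℕ) (M : Matroid α) {n : ℕ} (σ : ZMod n → α) : Prop :=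
  IsTCyclicOrdering t M σ ∧ ∀ i, 1 ≤ i → i ≤ n → Odd i → EvenAt t M σ i

/-! ### Connectivity and flowers -/

/-- The rank of the set `X` in the (finite) matroid `M`, as an integer. -/
noncomputable def rk {α : Type*} (M : Matroid α) (X : Set α) : ℤ :=
  ((M.eRk X).toNat : ℤ)

/-- The connectivity function `λ(X) = r(X) + r(E - X) - r(M)`. -/
noncomputable def conn {α : Type*} (M : Matroid α) (X : Set α) : ℤ :=
  rk M X + rk M (M.E \ X) - rk M M.E

/-- `X` is exactly `k`-separating: `λ(X) = k - 1`. -/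
def ExactlySeparating {α : Type*} (M : Matroid α) (k : ℕ) (X : Set α) : Prop :=
  conn M X = (k : ℤ) - 1

/-- `P = (P_1, …, P_m)` is a partition of `E` into nonempty sets. -/
def IsPartition {α : Type*} {m : ℕ} (P : Fin m → Set α) (E : Set α) : Prop :=
  (∀ i, (P i).Nonempty) ∧ (∀ i j, i ≠ j → Disjoint (P i) (P j)) ∧ ⋃ i, P i = E

/-- `P = (P_1, …, P_m)` is a `k`-flower of `M`; the partition with one petal counts as a
`k`-flower. Addition of petal indices is modulo `m`. -/
def IsFlower {α : Type*} (k : ℕ) (M : Matroid α) {m : ℕ} [NeZero m] (P : Fin m → Set α) : Prop :=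
  IsPartition P M.E ∧ (2 ≤ m → ∀ i, ExactlySeparating M k (P i)) ∧
    (3 ≤ m → ∀ i, ExactlySeparating M k (P i ∪ P (i + 1)))

/-- `I` is a set of consecutive members of the cyclic order `(1, 2, …, m)`. -/
def IsConsecutive {m : ℕ} [NeZero m] (I : Set (Fin m)) : Prop :=
  ∃ (a : Fin m) (l : ℕ), I = (fun j : ℕ => a + Fin.ofNat m j) '' Iio l

/-- `P` is a `k`-anemone: a `k`-flower for which every union of a nonempty proper subset of the
petals is exactly `k`-separating. -/
def IsAnemone {α : Type*} (k : ℕ) (M : Matroid α) {m : ℕ} [NeZero m] (P : Fin m → Set α) : Prop :=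
  IsFlower k M P ∧ ∀ I : Set (Fin m), I.Nonempty → I ≠ univ →
    ExactlySeparating M k (⋃ i ∈ I, P i)

/-- `P` is a `k`-daisy: a `k`-flower for which the union of a nonempty proper subset of the petals
is exactly `k`-separating precisely when these petals are consecutive. -/
def IsDaisy {α : Type*} (k : ℕ) (M : Matroid α) {m : ℕ} [NeZero m] (P : Fin m → Set α) : Prop :=
  IsFlower k M P ∧ ∀ I : Set (Fin m), I.Nonempty → I ≠ univ →
    (ExactlySeparating M k (⋃ i ∈ I, P i) ↔ IsConsecutive I)

/-! ### Concatenations -/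

/-- The cyclic interval `[i, j]` of `{1, …, n}`: `{i, …, j}` if `i ≤ j`, and
`{i, …, n} ∪ {1, …, j}` if `i > j`. -/
def cyclicInterval (n i j : ℕ) : Set ℕ :=
  if i ≤ j then Icc i j else Icc i n ∪ Icc 1 j

/-- `P` is the concatenation of `σ` given by the indices `1 ≤ k_1 < ⋯ < k_m ≤ n`, that is,
`P_i = {e_j : j ∈ [k_{i-1}, k_i - 1]}` for all `i`, with petal indices modulo `m`. -/
def IsConcatenationAt {α : Type*} {n : ℕ} (σ : ZMod n → α) {m : ℕ} [NeZero m] (k : Fin m → ℕ)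
    (P : Fin m → Set α) : Prop :=
  StrictMono k ∧ (∀ i, 1 ≤ k i ∧ k i ≤ n) ∧
    ∀ i, P i = (fun j : ℕ => σ (j : ZMod n)) '' cyclicInterval n (k (i - 1)) (k i - 1)

/-- `P` is an even concatenation of `σ`: every petal `{e_{j+1}, …, e_{j+k}}` has at least `t - 2`
elements, an even number of elements, and `j + 1` is odd. -/
def IsEvenConcatenation {α : Type*} (t : ℕ) {n : ℕ} (σ : ZMod n → α) {m : ℕ} [NeZero m]
    (P : Fin m → Set α) : Prop :=
  ∃ k : Fin m → ℕ, IsConcatenationAt σ k P ∧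
    ∀ i, t - 2 ≤ (P i).ncard ∧ Even (P i).ncard ∧ Odd (k (i - 1))

/-! ### Spikes and swirls -/

/-- `L = (L_1, …, L_r)` is a partition of `E` into pairs. -/
def IsPairPartition {α : Type*} {r : ℕ} (L : Fin r → Set α) (E : Set α) : Prop :=
  IsPartition L E ∧ ∀ i, (L i).ncard = 2

/-- `M` is a rank-`r` spike, as shown by the partition `L` of its ground set into pairs. -/
def IsSpike {α : Type*} (r : ℕ) (M : Matroid α) (L : Fin r → Set α) : Prop :=
  3 ≤ r ∧ IsPairPartition L M.E ∧
    ∀ i j, i ≠ j → IsCircuitOfSize M 4 (L i ∪ L j) ∧ IsCocircuitOfSize M 4 (L i ∪ L j)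

/-- A simple matroid: no loops and no parallel pairs. -/
def IsSimple {α : Type*} (M : Matroid α) : Prop :=
  ∀ e ∈ M.E, ∀ f ∈ M.E, M.Indep {e, f}

/-- `M` is a rank-`r` swirl, as shown by the partition `L` of its ground set into pairs: `M` is
obtained from a simple matroid `M₀` on the disjoint union of a basis `{b_1, …, b_r}` and the pairs
`L_i ⊆ cl {b_i, b_{i+1}}`, by deleting the basis. Here `b_i` is `Sum.inr i`, with indices modulo
`r`, and the elements of `M` are embedded by `Sum.inl`. -/
def IsSwirl {α : Type*} (r : ℕ) [NeZero r] (M : Matroid α) (L : Fin r → Set α) : Prop :=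
  3 ≤ r ∧ IsPairPartition L M.E ∧
    ∃ M₀ : Matroid (α ⊕ Fin r),
      M₀.E = Sum.inl '' M.E ∪ range Sum.inr ∧ IsSimple M₀ ∧ M₀.IsBase (range Sum.inr) ∧
      (∀ i, Sum.inl '' L i ⊆ M₀.closure {Sum.inr i, Sum.inr (i + 1)}) ∧
      M = (M₀.delete (range Sum.inr)).comap Sum.inl

/-- `σ = (e_1, f_1, e_2, f_2, …, e_r, f_r)` with `L_i = {e_i, f_i}`. -/
def ListsPairs {α : Type*} {r : ℕ} (σ : ZMod (2 * r) → α) (L : Fin r → Set α) : Prop :=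
  ∀ i : Fin r, L i = window σ (2 * (i : ℕ) + 1) 2

end CyclicMatroid

open CyclicMatroid

open CyclicMatroid

namespace CyclicMatroid

/-! ### Integer-valued rank -/

section Rank

/-! Write `T` for `truncLift`. Everything rests on the formula r_N(X) = min(r_M(X) + 1, r(M), |X|)
for N = T(M) (`rk_truncLift`), valid when r(M) ≥ 1. The formula is stable under duality, so whatever
is shown for circuits follows for cocircuits.

Orthogonality (a circuit and a cocircuit never meet in one element) forces n to be even in a
t-cyclic ordering with n ≥ 2t + 2, and forces alternative (i) to occur only for odd t and (ii) only
for even t. The two alternatives thereby merge into one condition, `HasWindows`: windows of length t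
are circuits at starts of one parity and cocircuits at starts of that parity shifted by t. If W is a
window of length t + 2 at a circuit start, two overlapping circuits and one cocircuit give r_M(W) =
r_M(W - e) = t for all e in W, and a cocircuit avoiding W gives r(M) ≥ t + 1. Hence r_N(W) = r_N(W -
e) = t + 1, so W is a circuit of N (`HasWindows.isCircuit_add_two`).

For even t = 2u + 2 and n = 2v, a window of 2l elements at a circuit start has rank l + u when u ≤ l
≤ v - u, and r(M) = v. Its connectivity is then 2u whatever l is, so even concatenations are (t -
1)-flowers. When all petals have at least t elements, each petal contains a set that is both a
circuit and a cocircuit. So for every nonempty proper union X of petals, both r(X) and r(E - X) grow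
by exactly one in N while r(M) stays fixed; connectivity grows by 2, matching the passage from t - 1
to t + 1, and anemones and daisies are preserved (`flower_truncLift`).

It remains to supply starting points with t = 4 and iterate. In a spike, a nonempty proper union of
j pairs has rank j + 1, hence connectivity 2. In a swirl, the rank of a union of pairs is the number
of joints it spans, and its connectivity is twice the number of cyclic runs of pairs, so it is
exactly 3-separating precisely when there is one run. For existence, the anemone is obtained from a
direct sum of parallel pairs, which already works at t = 2, and the daisy from an explicit swirl
over the rationals. -/

theorem rk_nonneg {α : Type*} {M : Matroid α} {X : Set α} : 0 ≤ rk M X := by simp [rk]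

theorem rk_empty {α : Type*} {M : Matroid α} : rk M ∅ = 0 := by simp [rk]

variable {α : Type*} {M : Matroid α} [M.Finite] {X Y C D I : Set α}

theorem natCast_toNat_eRk (M : Matroid α) [M.Finite] (X : Set α) :
    ((M.eRk X).toNat : ℕ∞) = M.eRk X :=
  ENat.natCast_toNat (Matroid.eRk_ne_top_iff.2 (M.isRkFinite_set X))

theorem rk_le_rk_iff {β : Type*} {N : Matroid β} [N.Finite] {Y : Set β} :
    rk M X ≤ rk N Y ↔ M.eRk X ≤ N.eRk Y := by
  rw [rk, rk, Nat.cast_le, ← natCast_toNat_eRk M, ← natCast_toNat_eRk N]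
  simp

theorem rk_mono (h : X ⊆ Y) : rk M X ≤ rk M Y := rk_le_rk_iff.2 (M.eRk_mono h)

theorem rk_inter_add_rk_union_le (M : Matroid α) [M.Finite] (X Y : Set α) :
    rk M (X ∩ Y) + rk M (X ∪ Y) ≤ rk M X + rk M Y := by
  have h := M.eRk_inter_add_eRk_union_le X Y
  rw [← natCast_toNat_eRk M, ← natCast_toNat_eRk M (X ∪ Y), ← natCast_toNat_eRk M X,
    ← natCast_toNat_eRk M Y] at h
  unfold rk
  exact_mod_cast h

theorem rk_union_le (M : Matroid α) [M.Finite] (X Y : Set α) :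
    rk M (X ∪ Y) ≤ rk M X + rk M Y := by
  linarith [rk_inter_add_rk_union_le M X Y, rk_nonneg (M := M) (X := X ∩ Y)]

theorem rk_le_ncard (hX : X.Finite) : rk M X ≤ X.ncard := by
  have h := M.eRk_le_encard X
  rw [← natCast_toNat_eRk M, ← hX.cast_ncard_eq] at h
  unfold rk
  exact_mod_cast h

theorem rk_le_rk_ground (M : Matroid α) [M.Finite] (X : Set α) : rk M X ≤ rk M M.E := by
  rw [rk_le_rk_iff, Matroid.eRk_ground]
  exact M.eRk_le_eRank X

theorem indep_iff_rk_eq (hX : X.Finite) : M.Indep X ↔ rk M X = X.ncard := by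
  rw [Matroid.indep_iff_eRk_eq_encard_of_finite hX, ← natCast_toNat_eRk M, ← hX.cast_ncard_eq, rk]
  norm_cast

theorem rk_lt_ncard (hX : M.Dep X) : rk M X < X.ncard := by
  have hf := M.ground_finite.subset hX.subset_ground
  exact (rk_le_ncard hf).lt_of_ne fun h ↦ hX.not_indep ((indep_iff_rk_eq hf).2 h)

theorem ncard_le_rk_of_indep (hI : M.Indep I) (h : I ⊆ X) : (I.ncard : ℤ) ≤ rk M X := by
  rw [← (indep_iff_rk_eq (M.ground_finite.subset hI.subset_ground)).1 hI]
  exact rk_mono h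

theorem exists_indep_ncard_eq_rk (M : Matroid α) [M.Finite] (X : Set α) :
    ∃ I ⊆ X, M.Indep I ∧ (I.ncard : ℤ) = rk M X := by
  obtain ⟨I, hI⟩ := M.exists_isBasis' X
  refine ⟨I, hI.subset, hI.indep, ?_⟩
  rw [rk, ← hI.encard_eq_eRk]
  rfl

theorem rk_eq_of_indep {d : ℤ} (h : ∀ J ⊆ X, M.Indep J → (J.ncard : ℤ) ≤ d) (hI : M.Indep I)
    (hIX : I ⊆ X) (hd : (I.ncard : ℤ) = d) : rk M X = d := by
  obtain ⟨J, hJX, hJ, hJd⟩ := exists_indep_ncard_eq_rk M X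
  exact le_antisymm (hJd ▸ h J hJX hJ) (hd ▸ ncard_le_rk_of_indep hI hIX)

theorem isBase_iff_ncard : M.IsBase I ↔ M.Indep I ∧ (I.ncard : ℤ) = rk M M.E := by
  refine ⟨fun h ↦ ⟨h.indep, ?_⟩, fun ⟨h, h'⟩ ↦ ?_⟩
  · rw [rk, Matroid.eRk_ground, ← h.encard_eq_eRank]
    rfl
  · refine h.isBase_of_eRk_ge (M.ground_finite.subset h.subset_ground) ?_
    rw [← Matroid.eRk_ground, ← rk_le_rk_iff, ← h',
      (indep_iff_rk_eq (M.ground_finite.subset h.subset_ground)).1 h]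

theorem rk_dual (hX : X ⊆ M.E) : rk M✶ X = X.ncard + rk M (M.E \ X) - rk M M.E := by
  have h := M.eRk_dual_add_eRank X hX
  rw [← Matroid.eRk_ground, ← natCast_toNat_eRk M, ← natCast_toNat_eRk M✶,
    ← natCast_toNat_eRk M M.E, ← natCast_toNat_eRk M (M.E \ X), ← (M.ground_finite.subset hX).cast_ncard_eq] at h
  unfold rk
  have h' : (M✶.eRk X).toNat + (M.eRk M.E).toNat = (M.eRk (M.E \ X)).toNat + X.ncard := by
    exact_mod_cast h
  omega

theorem ncard_diff_ground (hX : X ⊆ M.E) : ((M.E \ X).ncard : ℤ) = M.E.ncard - X.ncard := by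
  rw [ncard_sdiff hX (M.ground_finite.subset hX), Nat.cast_sub (ncard_le_ncard hX M.ground_finite)]

theorem isCircuit_iff_rk (hC : C ⊆ M.E) :
    M.IsCircuit C ↔ rk M C = C.ncard - 1 ∧ ∀ e ∈ C, rk M (C \ {e}) = C.ncard - 1 := by
  have hf := M.ground_finite.subset hC
  have hcard : ∀ e ∈ C, (((C \ {e}).ncard : ℕ) : ℤ) = C.ncard - 1 := fun e he ↦ by
    have := ncard_sdiff_singleton_add_one he hf
    omega
  rw [Matroid.isCircuit_iff_dep_forall_sdiff_singleton_indep]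
  constructor
  · rintro ⟨hd, hi⟩
    have key : ∀ e ∈ C, rk M (C \ {e}) = C.ncard - 1 := fun e he ↦ by
      rw [(indep_iff_rk_eq (hf.subset sdiff_subset)).1 (hi e he), hcard e he]
    refine ⟨?_, key⟩
    obtain ⟨e, he⟩ := hd.nonempty
    have h1 := rk_lt_ncard hd
    have h2 := key e he
    have h3 := rk_mono (M := M) (sdiff_subset : C \ {e} ⊆ C)
    omega
  · rintro ⟨hd, hi⟩
    refine ⟨⟨fun h ↦ ?_, hC⟩, fun e he ↦ ?_⟩
    · rw [indep_iff_rk_eq hf] at h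
      omega
    · rw [indep_iff_rk_eq (hf.subset sdiff_subset), hcard e he, hi e he]

theorem isCocircuit_iff_rk (hD : D ⊆ M.E) :
    M.IsCocircuit D ↔ rk M (M.E \ D) = rk M M.E - 1 ∧
      ∀ e ∈ D, rk M (insert e (M.E \ D)) = rk M M.E := by
  have hf := M.ground_finite.subset hD
  rw [Matroid.isCocircuit_def, isCircuit_iff_rk (M := M✶) hD, rk_dual hD]
  refine and_congr (by constructor <;> intro h <;> linarith) (forall₂_congr fun e he ↦ ?_)
  rw [rk_dual (sdiff_subset.trans hD)]
  have := ncard_sdiff_singleton_add_one he hf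
  have h2 : M.E \ (D \ {e}) = insert e (M.E \ D) := by
    ext x
    by_cases h : x = e
    · subst h; simp [hD he]
    · simp [h]
  rw [h2]
  constructor <;> intro h <;> omega

theorem rk_eq_of_isCircuit (hC : M.IsCircuit C) : rk M C = C.ncard - 1 :=
  ((isCircuit_iff_rk hC.subset_ground).1 hC).1

/-- A set that misses a cocircuit `D` gains rank as soon as an element of `D` is added. -/
theorem rk_add_one_le_of_isCocircuit (hD : M.IsCocircuit D) (hX : X ⊆ M.E) (hXD : Disjoint X D)
    (hXY : X ⊆ Y) (hY : (Y ∩ D).Nonempty) : rk M X + 1 ≤ rk M Y := by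
  obtain ⟨e, heY, heD⟩ := hY
  obtain ⟨h1, h2⟩ := (isCocircuit_iff_rk hD.subset_ground).1 hD
  have hsub : X ⊆ M.E \ D := subset_sdiff.2 ⟨hX, hXD⟩
  -- Submodularity of X + e against the hyperplane E - D: adding e raises the rank of the
  -- hyperplane, hence also that of its subset X.
  have h3 := rk_inter_add_rk_union_le M (insert e X) (M.E \ D)
  have h4 : insert e X ∩ (M.E \ D) = X := by
    ext x
    constructor
    · rintro ⟨rfl | h, h'⟩
      exacts [absurd heD h'.2, h]
    · exact fun h ↦ ⟨mem_insert_of_mem _ h, hsub h⟩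
  have h5 : insert e X ∪ (M.E \ D) = insert e (M.E \ D) := by
    rw [insert_union, union_eq_self_of_subset_left hsub]
  rw [h4, h5, h1, h2 e heD] at h3
  have h6 := rk_mono (M := M) (insert_subset heY hXY)
  linarith

end Rank

/-! ### Rank in the truncation and the Higgs lift -/

section TruncLift

variable {α : Type*} {M : Matroid α}

@[simp] theorem freeExtension_ground (M : Matroid α) :
    (freeExtension M).E = insert none (some '' M.E) := rfl

theorem freeExtension_indep {J : Set (Option α)} :
    (freeExtension M).Indep J ↔ FreeExtIndep M J := Iff.rfl

instance [M.Finite] : (freeExtension M).Finite :=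
  ⟨(M.ground_finite.image _).insert _⟩

theorem truncation_ground (M : Matroid α) : (truncation M).E = M.E := by
  ext x
  simp [truncation, Matroid.comap_ground_eq]

theorem higgsLift_ground (M : Matroid α) : (higgsLift M).E = M.E := by
  ext x
  simp [higgsLift, freeCoextension, Matroid.comap_ground_eq]

theorem truncLift_ground (M : Matroid α) : (truncLift M).E = M.E := by
  rw [truncLift, higgsLift_ground, truncation_ground]

instance [h : M.Finite] : (truncation M).Finite := ⟨by rw [truncation_ground]; exact h.1⟩
instance [h : M.Finite] : (higgsLift M).Finite := ⟨by rw [higgsLift_ground]; exact h.1⟩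
instance [h : M.Finite] : (truncLift M).Finite := ⟨by rw [truncLift_ground]; exact h.1⟩

/-- Positive rank makes `none` a nonloop of the free extension; contracting a loop would only delete
it, and the bases of `M` would survive. -/
theorem truncation_indep (h : ¬ M.IsBase ∅) {J : Set α} :
    (truncation M).Indep J ↔ M.Indep J ∧ ¬ M.IsBase J := by
  have hnl : (freeExtension M).IsNonloop none := by
    rw [← Matroid.indep_singleton, freeExtension_indep]
    have : (some ⁻¹' {none} : Set α) = ∅ := by ext; simp
    refine ⟨?_, fun _ ↦ ?_⟩ <;> rw [this]
    exacts [M.empty_indep, h]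
  rw [truncation, Matroid.comap_indep_iff_of_injOn (Option.some_injective _).injOn,
    hnl.contractElem_indep_iff, freeExtension_indep, FreeExtIndep, preimage_insert_none,
    preimage_some_image]
  simp

theorem exists_subset_ncard {I : Set α} {d : ℤ} (h0 : 0 ≤ d) (h : d ≤ I.ncard) :
    ∃ J ⊆ I, (J.ncard : ℤ) = d := by
  lift d to ℕ using h0
  obtain ⟨J, hJ, hd⟩ := exists_subset_card_eq (s := I) (n := d) (by exact_mod_cast h)
  exact ⟨J, hJ, by exact_mod_cast hd⟩

theorem rk_truncation [M.Finite] (h : 1 ≤ rk M M.E) (X : Set α) :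
    rk (truncation M) X = min (rk M X) (rk M M.E - 1) := by
  have h0 : ¬ M.IsBase ∅ := fun hb ↦ by
    have := (isBase_iff_ncard.1 hb).2
    rw [ncard_empty] at this
    push_cast at this
    linarith
  obtain ⟨I, hIX, hI, hId⟩ := exists_indep_ncard_eq_rk M X
  obtain ⟨J, hJI, hJ⟩ := exists_subset_ncard
    (d := min (rk M X) (rk M M.E - 1)) (le_min rk_nonneg (by linarith)) (by rw [hId]; simp)
  refine rk_eq_of_indep (fun K hKX hK ↦ ?_) ((truncation_indep h0).2 ⟨hI.subset hJI, fun hb ↦ ?_⟩)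
    (hJI.trans hIX) hJ
  · obtain ⟨hK1, hK2⟩ := (truncation_indep h0).1 hK
    have h1 := ncard_le_rk_of_indep hK1 hKX
    have h2 := ncard_le_rk_of_indep hK1 hK1.subset_ground
    have h3 : (K.ncard : ℤ) ≠ rk M M.E := fun h ↦ hK2 (isBase_iff_ncard.2 ⟨hK1, h⟩)
    exact le_min h1 (by omega)
  · have := (isBase_iff_ncard.1 hb).2
    omega

theorem ncard_le_preimage_some_add_one {J : Set (Option α)} :
    J.ncard ≤ (some ⁻¹' J : Set α).ncard + 1 ∧
      (none ∉ J → J.ncard = (some ⁻¹' J : Set α).ncard) := by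
  have h1 : J \ {none} = some '' (some ⁻¹' J : Set α) := by
    ext (_ | x) <;> simp
  have h2 : (J \ {none}).ncard = (some ⁻¹' J : Set α).ncard := by
    rw [h1, ncard_image_of_injective _ (Option.some_injective _)]
  refine ⟨?_, fun h ↦ ?_⟩
  · rw [← h2]
    have := ncard_le_ncard_sdiff_add_ncard J {none}
    simpa using this
  · rw [← h2, sdiff_singleton_eq_self h]

/-- The new element adds one to the rank of Y unless Y already spans. Only sets containing `none`
are needed, since these are the complements that arise when the dual rank is computed in
`rk_higgsLift`. -/
theorem rk_freeExtension_insert_none [M.Finite] {Y : Set α} :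
    rk (freeExtension M) (insert none (some '' Y)) = min (rk M Y + 1) (rk M M.E) := by
  obtain ⟨I, hIX, hI, hId⟩ := exists_indep_ncard_eq_rk M Y
  have hIf := M.ground_finite.subset hI.subset_ground
  have hub : ∀ J ⊆ insert none (some '' Y), (freeExtension M).Indep J →
      (J.ncard : ℤ) ≤ min (rk M Y + 1) (rk M M.E) := by
    intro J hJX hJ
    rw [freeExtension_indep] at hJ
    obtain ⟨c1, c2⟩ := ncard_le_preimage_some_add_one (J := J)
    have h1 := ncard_le_rk_of_indep hJ.1 (X := Y) (fun x hx ↦ by simpa using hJX hx)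
    have h2 := ncard_le_rk_of_indep hJ.1 hJ.1.subset_ground
    by_cases hn : none ∈ J
    · have h3 : ((some ⁻¹' J : Set α).ncard : ℤ) ≠ rk M M.E :=
        fun h ↦ hJ.2 hn (isBase_iff_ncard.2 ⟨hJ.1, h⟩)
      omega
    · have := c2 hn
      omega
  by_cases hb : M.IsBase I
  · refine rk_eq_of_indep hub (I := some '' I) ?_ ((image_mono hIX).trans (subset_insert _ _)) ?_
    · rw [freeExtension_indep, FreeExtIndep, preimage_some_image]
      exact ⟨hI, by simp⟩
    · rw [ncard_image_of_injective _ (Option.some_injective _)]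
      have := (isBase_iff_ncard.1 hb).2
      omega
  · refine rk_eq_of_indep hub (I := insert none (some '' I)) ?_
      (insert_subset_insert (image_mono hIX)) ?_
    · rw [freeExtension_indep, FreeExtIndep, preimage_insert_none, preimage_some_image]
      exact ⟨hI, fun _ ↦ hb⟩
    · rw [ncard_insert_of_notMem (by simp) (hIf.image _),
        ncard_image_of_injective _ (Option.some_injective _)]
      have h2 := ncard_le_rk_of_indep hI hI.subset_ground
      have h3 : (I.ncard : ℤ) ≠ rk M M.E := fun h ↦ hb (isBase_iff_ncard.2 ⟨hI, h⟩)
      push_cast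
      omega

/-- Deleting `none` does not affect the rank of X, so this is a rank in the dual of the free
extension of `M✶`. Both terms of the dual rank formula then concern sets containing `none`. -/
theorem rk_higgsLift [M.Finite] {X : Set α} (hX : X ⊆ M.E) :
    rk (higgsLift M) X = min (rk M X + 1) X.ncard := by
  have h1 : rk (higgsLift M) X = rk (freeExtension M✶)✶ (some '' X) := by
    rw [rk, rk, higgsLift, freeCoextension, Matroid.eRk_comap, Matroid.delete_eq_restrict,
      Matroid.restrict_eRk_eq]
    rintro _ ⟨x, hx, rfl⟩
    simpa using hX hx
  have hsub : some '' X ⊆ (freeExtension M✶).E :=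
    (image_mono hX).trans (subset_insert _ _)
  have h2 : (freeExtension M✶).E \ some '' X = insert none (some '' (M.E \ X)) := by
    ext (_ | x) <;> simp
  rw [h1, rk_dual hsub, h2, freeExtension_ground, rk_freeExtension_insert_none,
    rk_freeExtension_insert_none, ncard_image_of_injective _ (Option.some_injective _),
    rk_dual sdiff_subset, sdiff_sdiff_cancel_left hX, Matroid.dual_ground, rk_dual subset_rfl,
    sdiff_self, rk_empty, ncard_diff_ground hX]
  omega

theorem rk_truncLift [M.Finite] (h : 1 ≤ rk M M.E) {X : Set α} (hX : X ⊆ M.E) :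
    rk (truncLift M) X = min (min (rk M X + 1) (rk M M.E)) X.ncard := by
  rw [truncLift, rk_higgsLift (by rwa [truncation_ground]), rk_truncation h]
  omega

end TruncLift


/-! ### Windows of a cyclic ordering -/

section Window

variable {α : Type*} {n : ℕ} {σ : ZMod n → α} {i j k l : ℕ}

theorem window_congr (h : i ≡ j [MOD n]) : window σ i k = window σ j k := by
  have key : ∀ a b : ℕ, a ≡ b [MOD n] → window σ a k ⊆ window σ b k := by
    rintro a b hab _ ⟨x, ⟨h1, h2⟩, rfl⟩
    obtain ⟨d, rfl⟩ := Nat.exists_eq_add_of_le h1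
    refine ⟨b + d, ⟨by omega, by omega⟩, ?_⟩
    have := (ZMod.natCast_eq_natCast_iff _ _ _).2 hab
    simp [this]
  exact (key i j h).antisymm (key j i h.symm)

theorem window_add_self : window σ (i + n) k = window σ i k :=
  window_congr (by simp [Nat.ModEq])

theorem window_union : window σ i k ∪ window σ (i + k) l = window σ i (k + l) := by
  rw [window, window, window, ← image_union, add_assoc, Ico_union_Ico_eq_Ico] <;> omega

theorem window_subset_window (h1 : i ≤ j) (h2 : j + l ≤ i + k) : window σ j l ⊆ window σ i k :=
  image_mono (Ico_subset_Ico h1 h2)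

theorem mem_window (h1 : i ≤ j) (h2 : j < i + k) : σ j ∈ window σ i k :=
  ⟨j, ⟨h1, h2⟩, rfl⟩

theorem window_subset_range : window σ i k ⊆ range σ := by
  rintro _ ⟨x, -, rfl⟩
  exact mem_range_self _

theorem eq_of_apply_natCast_eq (hσ : Function.Injective σ) (h : σ (i : ZMod n) = σ (j : ZMod n))
    (h1 : i < j + n) (h2 : j < i + n) : i = j := by
  have hm := (ZMod.natCast_eq_natCast_iff _ _ _).1 (hσ h)
  rcases le_total i j with hij | hij
  · have := (Nat.modEq_iff_dvd' hij).1 hm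
    have := Nat.eq_zero_of_dvd_of_lt this (by omega)
    omega
  · have := (Nat.modEq_iff_dvd' hij).1 hm.symm
    have := Nat.eq_zero_of_dvd_of_lt this (by omega)
    omega

theorem window_disjoint (hσ : Function.Injective σ) (h1 : i + k ≤ j) (h2 : j + l ≤ i + n) :
    Disjoint (window σ i k) (window σ j l) := by
  rw [disjoint_left]
  rintro _ ⟨x, ⟨hx1, hx2⟩, rfl⟩ ⟨y, ⟨hy1, hy2⟩, hxy⟩
  have := eq_of_apply_natCast_eq hσ hxy (by omega) (by omega)
  omega

theorem ncard_window (hσ : Function.Injective σ) (h : k ≤ n) : (window σ i k).ncard = k := by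
  rw [window, InjOn.ncard_image]
  · simp [← Finset.coe_Ico, ncard_coe_finset]
  · rintro x ⟨hx1, hx2⟩ y ⟨hy1, hy2⟩ hxy
    exact eq_of_apply_natCast_eq hσ hxy (by omega) (by omega)

theorem window_self (hn : 0 < n) : window σ i n = range σ := by
  refine window_subset_range.antisymm ?_
  rintro _ ⟨z, rfl⟩
  have : NeZero n := ⟨hn.ne'⟩
  have h1 := Nat.mod_lt (z.val + (n - i % n)) hn
  refine ⟨i + (z.val + (n - i % n)) % n, ⟨by omega, by omega⟩, ?_⟩
  have h2 : ((i + (z.val + (n - i % n)) % n : ℕ) : ZMod n) = ((z.val : ℕ) : ZMod n) := by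
    rw [ZMod.natCast_eq_natCast_iff, Nat.ModEq, Nat.add_mod_mod]
    have h3 := Nat.mod_lt i hn
    have h4 := Nat.div_add_mod i n
    have h5 : i + (z.val + (n - i % n)) = z.val + n * (i / n + 1) := by
      rw [mul_add]
      omega
    rw [h5, Nat.add_mul_mod_self_left]
  simp only [h2, ZMod.natCast_zmod_val]

theorem range_diff_window (hσ : Function.Injective σ) (hn : 0 < n) (h : k ≤ n) :
    range σ \ window σ i k = window σ (i + k) (n - k) := by
  have h1 : window σ i k ∪ window σ (i + k) (n - k) = range σ := by
    rw [window_union, Nat.add_sub_cancel' h, window_self hn]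
  have h2 : Disjoint (window σ i k) (window σ (i + k) (n - k)) :=
    window_disjoint hσ le_rfl (by omega)
  rw [← h1, union_sdiff_left, h2.symm.sdiff_eq_left]

theorem window_inter_window_eq_singleton (hσ : Function.Injective σ) (h : 2 * k + 1 ≤ n) :
    window σ i (k + 1) ∩ window σ (i + k) (k + 1) = {σ ((i + k : ℕ) : ZMod n)} := by
  ext x
  constructor
  · rintro ⟨⟨x, ⟨hx1, hx2⟩, rfl⟩, ⟨y, ⟨hy1, hy2⟩, hxy⟩⟩
    have := eq_of_apply_natCast_eq hσ hxy (by omega) (by omega)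
    have : x = i + k := by omega
    rw [this]
    rfl
  · rintro rfl
    exact ⟨mem_window (by omega) (by omega), mem_window (by omega) (by omega)⟩

end Window

/-! ### Circuits and cocircuits on alternate windows -/

section HasWindows

variable {α : Type*} {n : ℕ} {σ : ZMod n → α} {M N : Matroid α} {t q : ℕ}

/-- The windows of length `t` with starts of the parity of `q` are circuits, and those with starts
of the parity of `q + t` are cocircuits. -/
def HasWindows (t : ℕ) (M : Matroid α) (σ : ZMod n → α) (q : ℕ) : Prop :=
  (∀ i, Even (i + q) → M.IsCircuit (window σ i t)) ∧
    ∀ i, Even (i + q + t) → M.IsCocircuit (window σ i t)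

theorem HasWindows.dual (h : HasWindows t M σ q) : HasWindows t M✶ σ (q + t) := by
  refine ⟨fun i hi ↦ h.2 i (by rwa [add_assoc]), fun i hi ↦ ?_⟩
  rw [Matroid.isCocircuit_def, Matroid.dual_dual]
  refine h.1 i ?_
  rw [show i + (q + t) + t = i + q + 2 * t by ring] at hi
  simpa [Nat.even_add] using hi

/-- `N` has the rank function of the Higgs lift of the truncation of `M`. -/
def HasTruncLiftRank (N M : Matroid α) : Prop :=
  N.E = M.E ∧ ∀ X ⊆ M.E, rk N X = min (min (rk M X + 1) (rk M M.E)) X.ncard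

theorem HasTruncLiftRank.rk_ground [M.Finite] (h : HasTruncLiftRank N M) :
    rk N M.E = rk M M.E := by
  have h1 := rk_le_ncard (M := M) M.ground_finite
  have h2 := h.2 M.E subset_rfl
  omega

/-- The rank formula is self-dual: passing to complements exchanges the bounds |X| and r(M). Working
with the rank function rather than with `truncLift` itself makes this usable for cocircuits without
comparing the dual construction as a matroid. -/
theorem HasTruncLiftRank.dual [M.Finite] [N.Finite] (h : HasTruncLiftRank N M) :
    HasTruncLiftRank N✶ M✶ := by
  refine ⟨h.1, fun X hX ↦ ?_⟩
  have hX' : X ⊆ M.E := hX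
  have h1 := h.2 (M.E \ X) sdiff_subset
  have h2 := rk_dual (M := N) (X := X) (by rwa [h.1])
  have h4 := rk_dual (M := M) hX'
  have h5 := rk_dual (M := M) subset_rfl
  rw [h.1, h.rk_ground] at h2
  rw [sdiff_self, rk_empty] at h5
  have h6 := ncard_diff_ground hX'
  rw [Matroid.dual_ground]
  omega

theorem hasTruncLiftRank_truncLift [M.Finite] (h : 1 ≤ rk M M.E) :
    HasTruncLiftRank (truncLift M) M :=
  ⟨truncLift_ground M, fun _ hX ↦ rk_truncLift h hX⟩

theorem rk_circuit_diff_singleton [M.Finite] {C : Set α} (hC : M.IsCircuit C) (e : α) :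
    rk M (C \ {e}) = C.ncard - 1 := by
  by_cases he : e ∈ C
  · exact ((isCircuit_iff_rk hC.subset_ground).1 hC).2 e he
  · rw [sdiff_singleton_eq_self he, rk_eq_of_isCircuit hC]

theorem rk_window_of_lt [M.Finite] (hσ : Function.Injective σ) {i j k : ℕ} (htn : t ≤ n)
    (hC : M.IsCircuit (window σ i t)) (h1 : i ≤ j) (h2 : j + k ≤ i + t) (hk : k < t) :
    rk M (window σ j k) = k := by
  have hsub : window σ j k ⊆ window σ i t := window_subset_window h1 h2
  have hss : window σ j k ⊂ window σ i t := hsub.ssubset_of_ne fun h ↦ by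
    have := congrArg ncard h
    rw [ncard_window hσ (by omega), ncard_window hσ htn] at this
    omega
  have hi := hC.ssubset_indep hss
  rw [(indep_iff_rk_eq (M.ground_finite.subset hi.subset_ground)).1 hi,
    ncard_window hσ (by omega)]

/-- The window W has rank t in M, and so does W minus any one of its elements. As r(M) ≥ t + 1, both
ranks become t + 1 in N, which is what a circuit of size t + 2 requires. -/
theorem HasWindows.isCircuit_add_two [M.Finite] (hσ : Function.Injective σ) (hE : range σ = M.E)
    (ht : 2 ≤ t) (hn : 2 * t + 2 ≤ n) (h : HasWindows t M σ q) (hN : HasTruncLiftRank N M)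
    [N.Finite] {i : ℕ} (hi : Even (i + q)) : N.IsCircuit (window σ i (t + 2)) := by
  have hWE : window σ i (t + 2) ⊆ M.E := hE ▸ window_subset_range
  have hC := h.1 i hi
  have hC2 := h.1 (i + 2) (by rw [add_right_comm]; exact hi.add even_two)
  have hD := h.2 (i + t) (by
    rw [show i + t + q + t = i + q + 2 * t by ring]; exact hi.add (even_two_mul t))
  have hD2 := h.2 (i + t + 2) (by
    rw [show i + t + 2 + q + t = i + q + 2 * (t + 1) by ring]; exact hi.add (even_two_mul _))
  have cW : (window σ i (t + 2)).ncard = t + 2 := ncard_window hσ (by omega)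
  have cC : ∀ j, (window σ j t).ncard = t := fun j ↦ ncard_window hσ (by omega)
  -- W is covered by two circuits of rank t - 1 that share t - 2 independent elements, so its rank
  -- is at most 2(t - 1) - (t - 2).
  have hup : rk M (window σ i (t + 2)) ≤ t := by
    have h1 := rk_inter_add_rk_union_le M (window σ i t) (window σ (i + 2) t)
    have h2 : window σ (i + 2) (t - 2) ⊆ window σ i t ∩ window σ (i + 2) t :=
      subset_inter (window_subset_window (by omega) (by omega))
        (window_subset_window (by omega) (by omega))
    have h3 := rk_mono (M := M) h2
    have h4 := rk_window_of_lt (k := t - 2) (j := i + 2) hσ (by omega) hC (by omega) (by omega)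
      (by omega)
    have h5 : window σ i (t + 2) ⊆ window σ i t ∪ window σ (i + 2) t := by
      rw [← window_union]
      exact union_subset_union_right _ (window_subset_window (by omega) (by omega))
    have h6 := rk_mono (M := M) h5
    have h7 := rk_eq_of_isCircuit hC
    have h8 := rk_eq_of_isCircuit hC2
    rw [cC] at h7 h8
    omega
  -- The first circuit keeps rank t - 1 after removing e. The cocircuit starting just behind it
  -- contains the last two elements of W, and at least one of these differs from e.
  have hlow : ∀ e, (t : ℤ) ≤ rk M (window σ i (t + 2) \ {e}) := by
    intro e
    have h1 := rk_circuit_diff_singleton hC e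
    rw [cC] at h1
    have hCD : Disjoint (window σ i t) (window σ (i + t) t) :=
      window_disjoint hσ le_rfl (by omega)
    have h2 := rk_add_one_le_of_isCocircuit hD (X := window σ i t \ {e})
      (Y := window σ i (t + 2) \ {e}) (sdiff_subset.trans hC.subset_ground)
      (hCD.mono_left sdiff_subset)
      (sdiff_subset_sdiff_left (window_subset_window le_rfl (by omega))) (by
        by_cases he : e = σ ((i + t : ℕ) : ZMod n)
        · refine ⟨σ ((i + t + 1 : ℕ) : ZMod n), ⟨mem_window (by omega) (by omega), ?_⟩,
            mem_window (by omega) (by omega)⟩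
          rw [mem_singleton_iff, he]
          intro heq
          have := eq_of_apply_natCast_eq hσ heq (by omega) (by omega)
          omega
        · exact ⟨σ ((i + t : ℕ) : ZMod n), ⟨mem_window (by omega) (by omega), Ne.symm he⟩,
            mem_window (by omega) (by omega)⟩)
    omega
  -- The cocircuit that follows W is disjoint from it because (t + 2) + t ≤ n.
  have hr : (t : ℤ) + 1 ≤ rk M M.E := by
    have h1 := rk_add_one_le_of_isCocircuit hD2 (Y := M.E) hWE
      (window_disjoint hσ (by omega) (by omega)) hWE
      ⟨_, hD2.subset_ground (mem_window le_rfl (by omega)), mem_window le_rfl (by omega)⟩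
    have h2 := hlow (σ 0)
    have h3 := rk_mono (M := M) (sdiff_subset : window σ i (t + 2) \ {σ 0} ⊆ window σ i (t + 2))
    omega
  rw [isCircuit_iff_rk (by rwa [hN.1]), hN.2 _ hWE, cW]
  constructor
  · have h2 := hlow (σ 0)
    have h3 := rk_mono (M := M) (sdiff_subset : window σ i (t + 2) \ {σ 0} ⊆ window σ i (t + 2))
    omega
  · intro e he
    have h2 := hlow e
    have h3 := rk_mono (M := M) (sdiff_subset : window σ i (t + 2) \ {e} ⊆ window σ i (t + 2))
    have h4 := ncard_sdiff_singleton_add_one he (M.ground_finite.subset hWE)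
    rw [hN.2 _ (sdiff_subset.trans hWE)]
    omega

theorem HasWindows.add_two [M.Finite] [N.Finite] (hσ : Function.Injective σ) (hE : range σ = M.E)
    (ht : 2 ≤ t) (hn : 2 * t + 2 ≤ n) (h : HasWindows t M σ q) (hN : HasTruncLiftRank N M) :
    HasWindows (t + 2) N σ q :=
  ⟨fun _ hi ↦ h.isCircuit_add_two hσ hE ht hn hN hi, fun _ hi ↦
    h.dual.isCircuit_add_two (M := M✶) hσ hE ht hn hN.dual (by
      rw [← add_assoc] at hi ⊢
      simpa [Nat.even_add] using hi)⟩

end HasWindows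

/-! ### `t`-cyclic orderings -/

section TCyclic

variable {α : Type*} {n : ℕ} {σ : ZMod n → α} {M : Matroid α} {t : ℕ}

theorem IsCyclicOrdering.finite (h : IsCyclicOrdering σ M.E) : M.Finite := by
  have : NeZero n := ⟨h.1.ne'⟩
  exact ⟨h.2.2 ▸ finite_range σ⟩

/-- Orthogonality: the congruence says that the last element of the circuit is the first of the
other window, and 2t ≤ n rules out a second common element around the cycle. -/
theorem not_isCocircuit_window (hσ : Function.Injective σ) (ht : 1 ≤ t) (hn : 2 * t ≤ n) {i j : ℕ}
    (hj : i + t ≡ j + 1 [MOD n]) (hC : M.IsCircuit (window σ i t)) :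
    ¬ M.IsCocircuit (window σ j t) := by
  intro hD
  obtain ⟨s, rfl⟩ := Nat.exists_eq_add_of_le' ht
  rw [← window_congr (i := i + s) (Nat.ModEq.add_right_cancel' 1 hj)] at hD
  exact hC.inter_isCocircuit_ne_singleton hD
    (window_inter_window_eq_singleton hσ (by omega))

theorem not_isCocircuit_window' (hσ : Function.Injective σ) (ht : 1 ≤ t) (hn : 2 * t ≤ n)
    {i j : ℕ} (hj : i + t ≡ j + 1 [MOD n]) (hC : M.IsCircuit (window σ j t)) :
    ¬ M.IsCocircuit (window σ i t) := fun hD ↦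
  not_isCocircuit_window (M := M✶) hσ ht hn hj hD hC.isCocircuit

/-- For odd n, each combination of the parity of t with an alternative, taken at a suitable odd
index (n or 1), yields a circuit and a cocircuit meeting in one element. -/
theorem IsTCyclicOrdering.even_card (h : IsTCyclicOrdering t M σ) (ht : 2 ≤ t)
    (hn : 2 * t + 2 ≤ n) : Even n := by
  obtain ⟨⟨hn0, hσ, hE⟩, -, -, h⟩ := h
  have hC : ∀ i, 1 ≤ i → i ≤ n → Odd i → M.IsCircuit (window σ i t) := fun i h1 h2 h3 ↦ by
    rcases h i h1 h2 h3 with h | h <;> exact h.1.1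
  by_contra hno
  rw [Nat.not_even_iff_odd] at hno
  have ht1 : 1 ≤ t := by omega
  have hnt : 2 * t ≤ n := by omega
  rcases Nat.even_or_odd t with hte | hto
  · rcases h n hn0 le_rfl hno with hat | hat
    · refine not_isCocircuit_window hσ ht1 hnt (i := n + 2 - t) (j := n + 1) ?_ ?_ hat.2.1
      · rw [show n + 2 - t + t = n + 1 + 1 by omega]
      · exact hC _ (by omega) (by omega) (by rw [Nat.odd_iff, Nat.even_iff] at *; omega)
    · refine not_isCocircuit_window' hσ ht1 hnt (i := n) (j := t - 1) ?_ ?_ hat.2.1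
      · rw [show t - 1 + 1 = t by omega]
        simp [Nat.ModEq]
      · exact hC _ (by omega) (by omega) (by rw [Nat.odd_iff, Nat.even_iff] at *; omega)
  · rcases h 1 le_rfl hn0 odd_one with hat | hat
    · refine not_isCocircuit_window hσ ht1 hnt (i := n + 3 - t) (j := 2) ?_ ?_ hat.2.1
      · rw [show n + 3 - t + t = n + (2 + 1) by omega]
        simp [Nat.ModEq]
      · exact hC _ (by rw [Nat.odd_iff] at *; omega) (by rw [Nat.odd_iff] at *; omega)
          (by rw [Nat.odd_iff] at *; omega)
    · refine not_isCocircuit_window' hσ ht1 hnt (i := 1) (j := t) ?_ ?_ hat.2.1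
      · rw [add_comm]
      · exact hC _ (by omega) (by omega) hto

theorem exists_odd_modEq (hn : Even n) (hn0 : 0 < n) {i : ℕ} (hi : Odd i) :
    ∃ j, 1 ≤ j ∧ j ≤ n ∧ Odd j ∧ j ≡ i [MOD n] := by
  have hi1 : 1 ≤ i := hi.pos
  refine ⟨(i - 1) % n + 1, by omega, Nat.mod_lt _ hn0, ?_, ?_⟩
  · have h1 := Nat.div_add_mod (i - 1) n
    have h2 := (hn.mul_right ((i - 1) / n))
    rw [Nat.odd_iff, Nat.even_iff] at *
    omega
  · have := (Nat.mod_modEq (i - 1) n).add_right 1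
    rwa [Nat.sub_add_cancel hi1] at this

/-- With n even, parity of a subscript is meaningful modulo n. Alternative (i) with t even, or (ii)
with t odd, would give a circuit with an odd start whose first element is the last element of a
cocircuit. So the parity of t decides the alternative, uniformly in i. -/
theorem IsTCyclicOrdering.hasWindows (h : IsTCyclicOrdering t M σ) (ht : 2 ≤ t)
    (hn : 2 * t + 2 ≤ n) : HasWindows t M σ 1 ∧ (OddAt t M σ 1 → Odd t) ∧
      (EvenAt t M σ 1 → Even t) := by
  have hne := h.even_card ht hn
  obtain ⟨⟨hn0, hσ, hE⟩, -, -, h⟩ := h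
  have h' : ∀ i, Odd i → OddAt t M σ i ∨ EvenAt t M σ i := fun i hi ↦ by
    obtain ⟨j, h1, h2, h3, h4⟩ := exists_odd_modEq hne hn0 hi
    have := h j h1 h2 h3
    rwa [OddAt, EvenAt, window_congr h4, window_congr (h4.add_right 1)] at this
  have hC : ∀ i, Odd i → M.IsCircuit (window σ i t) := fun i h3 ↦ by
    rcases h' i h3 with h | h <;> exact h.1.1
  have ht1 : 1 ≤ t := by omega
  have hnt : 2 * t ≤ n := by omega
  have hodd : ∀ i, Odd i → OddAt t M σ i → Odd t := fun i hi hat ↦ by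
    by_contra hto
    refine not_isCocircuit_window' hσ ht1 hnt (i := i + 1) (j := i + t) ?_ ?_ hat.2.1
    · rw [add_right_comm]
    · exact hC _ (by rw [Nat.odd_iff] at *; omega)
  have heven : ∀ i, Odd i → EvenAt t M σ i → Even t := fun i hi hat ↦ by
    by_contra hte
    refine not_isCocircuit_window' hσ ht1 hnt (i := i) (j := i + (t - 1)) ?_ ?_ hat.2.1
    · rw [add_assoc, Nat.sub_add_cancel ht1]
    · exact hC _ (by rw [Nat.odd_iff, Nat.even_iff] at *; omega)
  refine ⟨⟨fun i hi ↦ hC i (by rw [Nat.odd_iff, Nat.even_iff] at *; omega), fun i hi ↦ ?_⟩,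
    hodd 1 odd_one, heven 1 odd_one⟩
  rcases Nat.even_or_odd t with hte | hto
  · have hi' : Odd i := by rw [Nat.odd_iff, Nat.even_iff] at *; omega
    rcases h' i hi' with h | h
    · exact absurd hte (Nat.not_even_iff_odd.2 (hodd i hi' h))
    · exact h.2.1
  -- The index i - 1 is written as i + (n - 1), which also covers i = 0.
  · have hi' : Odd (i + (n - 1)) := by rw [Nat.odd_iff, Nat.even_iff] at *; omega
    rcases h' _ hi' with h | h
    · have := h.2.1
      rwa [add_assoc, Nat.sub_add_cancel hn0, window_add_self] at this
    · exact absurd hto (Nat.not_odd_iff_even.2 (heven _ hi' h))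

theorem HasWindows.isTCyclicOrdering (hσ : IsCyclicOrdering σ M.E) (ht : 1 ≤ t) (hn : t + 1 ≤ n)
    (h : HasWindows t M σ 1) : IsTCyclicOrdering t M σ ∧
      (Odd t → IsOddTCyclicOrdering t M σ) ∧ (Even t → IsEvenTCyclicOrdering t M σ) := by
  have hc : ∀ i, (window σ i t).ncard = t := fun i ↦ ncard_window hσ.2.1 (by omega)
  have hodd : Odd t → ∀ i, Odd i → OddAt t M σ i := fun hto i hi ↦
    ⟨⟨h.1 i (by rw [Nat.odd_iff, Nat.even_iff] at *; omega), hc _⟩,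
      h.2 (i + 1) (by rw [Nat.odd_iff, Nat.even_iff] at *; omega), hc _⟩
  have heven : Even t → ∀ i, Odd i → EvenAt t M σ i := fun hte i hi ↦
    ⟨⟨h.1 i (by rw [Nat.odd_iff, Nat.even_iff] at *; omega), hc _⟩,
      h.2 i (by rw [Nat.odd_iff, Nat.even_iff] at *; omega), hc _⟩
  have hT : IsTCyclicOrdering t M σ := ⟨hσ, ht, hn, fun i _ _ hi ↦ by
    rcases Nat.even_or_odd t with hte | hto
    exacts [Or.inr (heven hte i hi), Or.inl (hodd hto i hi)]⟩
  exact ⟨hT, fun hto ↦ ⟨hT, fun i _ _ hi ↦ hodd hto i hi⟩,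
    fun hte ↦ ⟨hT, fun i _ _ hi ↦ heven hte i hi⟩⟩

theorem HasWindows.one_le_rk [M.Finite] {q : ℕ} (h : HasWindows t M σ q) : 1 ≤ rk M M.E := by
  have hD := h.2 (q + t) (by
    rw [show q + t + q + t = 2 * (q + t) by ring]; exact even_two_mul _)
  have h1 := rk_add_one_le_of_isCocircuit hD (empty_subset M.E) (empty_disjoint _)
    (empty_subset M.E) (by rw [inter_eq_right.2 hD.subset_ground]; exact hD.nonempty)
  rwa [rk_empty, zero_add] at h1

theorem HasWindows.truncLift [M.Finite] (hσ : Function.Injective σ) (hE : range σ = M.E)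
    (ht : 2 ≤ t) (hn : 2 * t + 2 ≤ n) {q : ℕ} (h : HasWindows t M σ q) :
    HasWindows (t + 2) (truncLift M) σ q :=
  h.add_two hσ hE ht hn (hasTruncLiftRank_truncLift h.one_le_rk)

/-- The Higgs lift of the truncation turns `t`-cyclic orderings into `(t + 2)`-cyclic orderings. -/
theorem isTCyclicOrdering_truncLift (h : IsTCyclicOrdering t M σ) (ht : 2 ≤ t)
    (hn : 2 * t + 2 ≤ n) :
    IsTCyclicOrdering (t + 2) (truncLift M) σ ∧
      (IsOddTCyclicOrdering t M σ → IsOddTCyclicOrdering (t + 2) (truncLift M) σ) ∧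
      (IsEvenTCyclicOrdering t M σ → IsEvenTCyclicOrdering (t + 2) (truncLift M) σ) := by
  have := h.1.finite
  obtain ⟨hW, h1, h2⟩ := h.hasWindows ht hn
  have hW' := hW.truncLift h.1.2.1 h.1.2.2 ht hn
  have hpos := h.1.1
  obtain ⟨h3, h4, h5⟩ := hW'.isTCyclicOrdering (by rw [truncLift_ground]; exact h.1) (by omega)
    (by omega)
  exact ⟨h3, fun ho ↦ h4 ((h1 (ho.2 1 le_rfl hpos odd_one)).add_even even_two),
    fun he ↦ h5 ((h2 (he.2 1 le_rfl hpos odd_one)).add even_two)⟩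

end TCyclic


/-! ### Concatenations -/

section Concatenation

variable {α : Type*} {n m : ℕ} {σ : ZMod n → α} {k : Fin m → ℕ} {P : Fin m → Set α}

theorem exists_ne_ne (hm : 3 ≤ m) (a b : Fin m) : ∃ c, c ≠ a ∧ c ≠ b := by
  by_contra! h
  have h1 : (Finset.univ : Finset (Fin m)) ⊆ {a, b} := fun c _ ↦ by
    by_cases hc : c = a
    · simp [hc]
    · simp [h c hc]
  have h2 := (Finset.card_le_card h1).trans Finset.card_le_two
  rw [Finset.card_univ, Fintype.card_fin] at h2
  omega

theorem IsPartition.disjoint_biUnion {E : Set α} (h : IsPartition P E) {I : Set (Fin m)}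
    {c : Fin m} (hc : c ∉ I) : Disjoint (⋃ i ∈ I, P i) (P c) := by
  simp only [disjoint_iUnion_left]
  exact fun i hi ↦ h.2.1 i c (fun hic ↦ hc (hic ▸ hi))

theorem IsPartition.subset {E : Set α} (h : IsPartition P E) (i : Fin m) : P i ⊆ E :=
  h.2.2 ▸ subset_iUnion P i

theorem IsPartition.biUnion_subset {E : Set α} (h : IsPartition P E) (I : Set (Fin m)) :
    ⋃ i ∈ I, P i ⊆ E :=
  iUnion₂_subset fun i _ ↦ h.subset i

theorem IsPartition.diff_biUnion {E : Set α} (h : IsPartition P E) (I : Set (Fin m)) :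
    E \ ⋃ i ∈ I, P i = ⋃ i ∈ Iᶜ, P i := by
  have h1 : E = (⋃ i ∈ I, P i) ∪ ⋃ i ∈ Iᶜ, P i := by
    rw [← biUnion_union, union_compl_self, biUnion_univ, h.2.2]
  have h2 : Disjoint (⋃ i ∈ I, P i) (⋃ i ∈ Iᶜ, P i) := by
    simp only [disjoint_iUnion_right]
    exact fun c hc ↦ h.disjoint_biUnion hc
  rw [h1, union_sdiff_left, h2.symm.sdiff_eq_left]

variable [NeZero m]

theorem Fin.val_zero_sub_one : ((0 - 1 : Fin m) : ℕ) = m - 1 := by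
  obtain ⟨m', rfl⟩ := Nat.exists_eq_succ_of_ne_zero (NeZero.ne m)
  rw [zero_sub, Fin.coe_neg_one]
  rfl

theorem Fin.val_sub_one {i : Fin m} (hi : i ≠ 0) : ((i - 1 : Fin m) : ℕ) = i - 1 :=
  Fin.val_sub_one_of_ne_zero hi

theorem cyclicInterval_subset {a b : ℕ} (ha : 1 ≤ a) (hb : b ≤ n) :
    cyclicInterval n a b ⊆ Icc 1 n := by
  unfold cyclicInterval
  split_ifs
  · exact Icc_subset_Icc ha hb
  · exact union_subset (Icc_subset_Icc_left ha) (Icc_subset_Icc_right hb)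

/-- Petal `0` alone wraps past n: its left end `k (0 - 1)` is the largest of the indices. All cyclic
intervals thus turn into linear inequalities. -/
theorem mem_cyclicInterval_concat_iff (hk : StrictMono k) (hb : ∀ i, 1 ≤ k i ∧ k i ≤ n) {x : ℕ}
    (hx : x ∈ Icc 1 n) (i : Fin m) : x ∈ cyclicInterval n (k (i - 1)) (k i - 1) ↔
      if i = 0 then x < k 0 ∨ k (0 - 1) ≤ x else k (i - 1) ≤ x ∧ x < k i := by
  obtain ⟨hx1, hx2⟩ := hx
  have := hb i
  split_ifs with h
  · subst h
    have h1 : k 0 ≤ k (0 - 1) := hk.monotone (by simp)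
    rw [cyclicInterval, if_neg (by omega)]
    simp only [mem_union, mem_Icc]
    omega
  · have h0 : (i : ℕ) ≠ 0 := fun h0 ↦ h (Fin.ext h0)
    have h1 : k (i - 1) < k i := hk (by rw [Fin.lt_def, Fin.val_sub_one h]; omega)
    rw [cyclicInterval, if_pos (by omega), mem_Icc]
    omega

theorem existsUnique_mem_cyclicInterval (hk : StrictMono k) (hb : ∀ i, 1 ≤ k i ∧ k i ≤ n) {x : ℕ}
    (hx : x ∈ Icc 1 n) : ∃! i, x ∈ cyclicInterval n (k (i - 1)) (k i - 1) := by
  simp only [mem_cyclicInterval_concat_iff hk hb hx]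
  have hlt : ∀ i j : Fin m, i < j → ¬ ((if i = 0 then x < k 0 ∨ k (0 - 1) ≤ x else
      k (i - 1) ≤ x ∧ x < k i) ∧ if j = 0 then x < k 0 ∨ k (0 - 1) ≤ x else
      k (j - 1) ≤ x ∧ x < k j) := by
    rintro i j hij ⟨h1, h2⟩
    rw [Fin.lt_def] at hij
    have hj : j ≠ 0 := by rintro rfl; simp at hij
    rw [if_neg hj] at h2
    have h3 : k i ≤ k (j - 1) := hk.monotone (by rw [Fin.le_def, Fin.val_sub_one hj]; omega)
    split_ifs at h1 with h
    · subst h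
      have h4 : k j ≤ k (0 - 1) := hk.monotone (by rw [Fin.le_def, Fin.val_zero_sub_one]; omega)
      omega
    · omega
  refine existsUnique_of_exists_of_unique ?_ fun i j hi hj ↦ ?_
  · by_cases hex : ∃ i, x < k i
    · obtain ⟨i, hi, hmin⟩ := WellFounded.has_min (wellFounded_lt (α := Fin m)) {i | x < k i} hex
      refine ⟨i, ?_⟩
      split_ifs with h
      · subst h
        exact Or.inl hi
      · refine ⟨?_, hi⟩
        by_contra hlt
        refine hmin (i - 1) (by simpa using hlt) ?_
        have h0 : (i : ℕ) ≠ 0 := fun h0 ↦ h (Fin.ext h0)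
        rw [Fin.lt_def, Fin.val_sub_one h]
        omega
    · push Not at hex
      exact ⟨0, by rw [if_pos rfl]; exact Or.inr (hex _)⟩
  · rcases lt_trichotomy i j with h | h | h
    exacts [absurd ⟨hi, hj⟩ (hlt i j h), h, absurd ⟨hj, hi⟩ (hlt j i h)]

theorem IsConcatenationAt.isPartition (h : IsConcatenationAt σ k P) (hσ : Function.Injective σ)
    (hn : 0 < n) : IsPartition P (range σ) := by
  obtain ⟨hk, hb, hP⟩ := h
  have hsub : ∀ i, cyclicInterval n (k (i - 1)) (k i - 1) ⊆ Icc 1 n := fun i ↦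
    cyclicInterval_subset (hb _).1 (by have := hb i; omega)
  refine ⟨fun i ↦ ?_, fun i j hij ↦ ?_, ?_⟩
  · rw [hP i]
    refine Nonempty.image _ ⟨k (i - 1), ?_⟩
    have := hb (i - 1)
    unfold cyclicInterval
    split_ifs with h
    · exact ⟨le_rfl, h⟩
    · exact Or.inl ⟨le_rfl, this.2⟩
  · rw [hP i, hP j, disjoint_left]
    rintro _ ⟨x, hx, rfl⟩ ⟨y, hy, hxy⟩
    have hx' := hsub i hx
    have hy' := hsub j hy
    have hyx : y = x := eq_of_apply_natCast_eq hσ hxy (by have := hx'.1; have := hy'.2; omega)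
      (by have := hy'.1; have := hx'.2; omega)
    subst hyx
    exact hij ((existsUnique_mem_cyclicInterval hk hb hx').unique hx hy)
  · refine subset_antisymm (iUnion_subset fun i ↦ ?_) ?_
    · rw [hP i]
      rintro _ ⟨x, -, rfl⟩
      exact mem_range_self _
    · rw [← window_self (i := 1) hn]
      rintro _ ⟨x, ⟨hx1, hx2⟩, rfl⟩
      obtain ⟨i, hi, -⟩ := existsUnique_mem_cyclicInterval hk hb (x := x) ⟨hx1, by omega⟩
      exact mem_iUnion.2 ⟨i, by rw [hP i]; exact ⟨x, hi, rfl⟩⟩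

theorem image_cyclicInterval {a b : ℕ} (ha : 1 ≤ a ∧ a ≤ n) (hb : 1 ≤ b ∧ b ≤ n) :
    ∃ l, l ≤ n ∧ a + l ≡ b [MOD n] ∧
      (fun j : ℕ ↦ σ (j : ZMod n)) '' cyclicInterval n a (b - 1) = window σ a l := by
  by_cases h : a < b
  · refine ⟨b - a, by omega, by rw [Nat.add_sub_cancel' h.le], ?_⟩
    rw [cyclicInterval, if_pos (by omega), window]
    congr 1
    ext x
    simp only [mem_Icc, mem_Ico]
    omega
  -- The wrapped case. Here a = b means a single petal, and the length is then n rather than 0.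
  · refine ⟨(n + 1 - a) + (b - 1), by omega, ?_, ?_⟩
    · rw [show a + (n + 1 - a + (b - 1)) = b + n by omega]
      simp [Nat.ModEq]
    · rw [cyclicInterval, if_neg (by omega), image_union, ← window_union,
        show a + (n + 1 - a) = 1 + n by omega, window_add_self, window, window]
      congr 2
      all_goals
        ext x
        simp only [mem_Icc, mem_Ico]
        omega

theorem IsConcatenationAt.eq_window (h : IsConcatenationAt σ k P) (hσ : Function.Injective σ)
    (i : Fin m) : (P i).ncard ≤ n ∧ k (i - 1) + (P i).ncard ≡ k i [MOD n] ∧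
      P i = window σ (k (i - 1)) (P i).ncard := by
  obtain ⟨l, h1, h2, h3⟩ := image_cyclicInterval (σ := σ) (h.2.1 (i - 1)) (h.2.1 i)
  rw [← h.2.2 i] at h3
  have h4 : (P i).ncard = l := by rw [h3, ncard_window hσ h1]
  rw [h4]
  exact ⟨h1, h2, h3⟩

end Concatenation

/-! ### Ranks of windows and flowers -/

section Flower

variable {α : Type*} {n : ℕ} {σ : ZMod n → α} {M N : Matroid α} {u v : ℕ}

/-- The first 2u elements lie properly inside a circuit, so they are independent. From then on each
further two elements raise the rank by exactly one: at most one because they complete a circuit of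
rank 2u + 1 whose other 2u elements are already present, at least one because they meet a cocircuit
that avoids the earlier elements. The bound on l leaves room for that cocircuit. -/
theorem rk_window [M.Finite] (hσ : Function.Injective σ) (hE : range σ = M.E) (hn : n = 2 * v)
    (huv : 2 * u + 1 ≤ v) {q : ℕ} (h : HasWindows (2 * u + 2) M σ q) {i l : ℕ} (hi : Even (i + q))
    (hl : u ≤ l) (hlv : l + u ≤ v) : rk M (window σ i (2 * l)) = l + u := by
  induction l, hl using Nat.le_induction with
  | base =>
    rw [rk_window_of_lt hσ (by omega) (h.1 i hi) le_rfl (by omega) (by omega)]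
    push_cast
    ring
  | succ l hl ih =>
    have ih := ih (by omega)
    have hWE : window σ i (2 * l) ⊆ M.E := hE ▸ window_subset_range
    have hC := h.1 (i + 2 * (l - u)) (by
      rw [add_right_comm]; exact hi.add (even_two_mul _))
    have hD := h.2 (i + 2 * l) (by
      rw [show i + 2 * l + q + (2 * u + 2) = i + q + 2 * (l + u + 1) by ring]
      exact hi.add (even_two_mul _))
    have h1 := rk_add_one_le_of_isCocircuit hD hWE (Y := window σ i (2 * (l + 1)))
      (window_disjoint hσ le_rfl (by omega)) (window_subset_window le_rfl (by omega))
      ⟨_, mem_window (j := i + 2 * l) (by omega) (by omega), mem_window le_rfl (by omega)⟩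
    have h2 := rk_inter_add_rk_union_le M (window σ i (2 * l))
      (window σ (i + 2 * (l - u)) (2 * u + 2))
    have h3 : window σ (i + 2 * (l - u)) (2 * u) ⊆
        window σ i (2 * l) ∩ window σ (i + 2 * (l - u)) (2 * u + 2) :=
      subset_inter (window_subset_window (by omega) (by omega))
        (window_subset_window (by omega) (by omega))
    have h4 := rk_mono (M := M) h3
    rw [rk_window_of_lt hσ (by omega) hC le_rfl (by omega) (by omega)] at h4
    have h5 : window σ i (2 * (l + 1)) ⊆
        window σ i (2 * l) ∪ window σ (i + 2 * (l - u)) (2 * u + 2) := by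
      rw [mul_add, ← window_union]
      exact union_subset_union_right _ (window_subset_window (by omega) (by omega))
    have h6 := rk_mono (M := M) h5
    have h7 := rk_eq_of_isCircuit hC
    rw [ncard_window hσ (by omega)] at h7
    push_cast at *
    omega

theorem rk_compl_window_of_lt [M.Finite] (hσ : Function.Injective σ) {i k t : ℕ} (htn : t ≤ n)
    (hD : M.IsCocircuit (window σ i t)) (hk : k < t) : rk M (M.E \ window σ i k) = rk M M.E := by
  refine le_antisymm (rk_le_rk_ground M _) ?_
  have h1 := rk_window_of_lt (M := M✶) (j := i) (k := k) hσ htn hD le_rfl (by omega) hk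
  have hsub : window σ i k ⊆ M.E :=
    (window_subset_window le_rfl (by omega)).trans hD.subset_ground
  rw [rk_dual hsub, ncard_window hσ (by omega)] at h1
  linarith

/-- Removing 2u elements, a proper part of a cocircuit, leaves a spanning set, and this set is the
longest window covered by `rk_window`. -/
theorem rk_ground_of_hasWindows [M.Finite] (hσ : Function.Injective σ) (hE : range σ = M.E)
    (hn : n = 2 * v) (huv : 2 * u + 1 ≤ v) {q : ℕ} (h : HasWindows (2 * u + 2) M σ q) :
    rk M M.E = v := by
  have hq : Even (q + q) := ⟨q, rfl⟩
  have h2 : Even (q + 2 * (v - u) + q + (2 * u + 2)) := by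
    rw [show q + 2 * (v - u) + q + (2 * u + 2) = 2 * (q + (v - u) + u + 1) by ring]
    exact even_two_mul _
  have h3 := rk_compl_window_of_lt (k := 2 * u) hσ (by omega) (h.2 _ h2) (by omega)
  have h4 : M.E \ window σ (q + 2 * (v - u)) (2 * u) = window σ q (2 * (v - u)) := by
    have h5 := range_diff_window (i := q) (k := 2 * (v - u)) hσ (by omega) (by omega)
    rw [show n - 2 * (v - u) = 2 * u by omega] at h5
    rw [← h5, ← hE, sdiff_sdiff_cancel_left window_subset_range]
  rw [h4, rk_window hσ hE hn huv h hq (by omega) (by omega)] at h3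
  rw [← h3]
  omega

theorem conn_window [M.Finite] (hσ : Function.Injective σ) (hE : range σ = M.E) (hn : n = 2 * v)
    (huv : 2 * u + 1 ≤ v) {q : ℕ} (h : HasWindows (2 * u + 2) M σ q) {i l : ℕ} (hi : Even (i + q))
    (hl : u ≤ l) (hlv : l + u ≤ v) : conn M (window σ i (2 * l)) = 2 * u := by
  rw [conn, rk_window hσ hE hn huv h hi hl hlv, rk_ground_of_hasWindows hσ hE hn huv h, ← hE,
    range_diff_window hσ (by omega) (by omega), show n - 2 * l = 2 * (v - l) by omega,
    rk_window hσ hE hn huv h (by rw [add_right_comm]; exact hi.add (even_two_mul _)) (by omega)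
      (by omega)]
  omega

theorem isFlower_of_isEvenConcatenation [M.Finite] (hσ : Function.Injective σ)
    (hE : range σ = M.E) (hn : n = 2 * v) (huv : 2 * u + 1 ≤ v)
    (h : HasWindows (2 * u + 2) M σ 1) {m : ℕ} [NeZero m] {P : Fin m → Set α}
    (hP : IsEvenConcatenation (2 * u + 2) σ P) : IsFlower (2 * u + 1) M P := by
  obtain ⟨k, hk, hP⟩ := hP
  have hpart := hk.isPartition hσ (by omega)
  rw [hE] at hpart
  have hfin : ∀ X : Set α, X ⊆ M.E → X.Finite := fun X hX ↦ M.ground_finite.subset hX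
  have hcE : M.E.ncard = n := by
    rw [← hE, ← window_self (i := 0) (by omega : 0 < n), ncard_window hσ le_rfl]
  have hsep : ∀ i l, Odd i → Even l → 2 * u ≤ l → l + 2 * u ≤ n →
      ExactlySeparating M (2 * u + 1) (window σ i l) := by
    rintro i l hi hl h1 h2
    obtain ⟨l, rfl⟩ := hl.two_dvd
    rw [ExactlySeparating, conn_window hσ hE hn huv h
      (by rw [Nat.odd_iff, Nat.even_iff] at *; omega) (by omega) (by omega)]
    push_cast
    ring
  -- A petal outside X supplies the 2u elements of the complement that the upper bound on the window
  -- length requires.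
  have hcard : ∀ (X : Set α) (c : Fin m), X ⊆ M.E → Disjoint X (P c) → X.ncard + 2 * u ≤ n := by
    intro X c hX hXc
    have h1 := (hP c).1
    have h2 := ncard_union_eq hXc (hfin _ hX) (hfin _ (hpart.subset c))
    have h3 := ncard_le_ncard (union_subset hX (hpart.subset c)) M.ground_finite
    omega
  refine ⟨hpart, fun hm i ↦ ?_, fun hm i ↦ ?_⟩
  · obtain ⟨c, hc⟩ : ∃ c, c ≠ i := by
      have : Nontrivial (Fin m) := Fin.nontrivial_iff_two_le.2 hm
      exact exists_ne i
    rw [(hk.eq_window hσ i).2.2]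
    refine hsep _ _ (hP i).2.2 (hP i).2.1 (by have := (hP i).1; omega) ?_
    exact hcard _ c (hpart.subset i) (hpart.2.1 _ _ hc.symm)
  · obtain ⟨c, hc1, hc2⟩ := exists_ne_ne hm i (i + 1)
    have h1 := hk.eq_window hσ i
    have h2 := hk.eq_window hσ (i + 1)
    have hU : P i ∪ P (i + 1) = window σ (k (i - 1)) ((P i).ncard + (P (i + 1)).ncard) := by
      rw [← window_union, window_congr h1.2.1, ← h1.2.2]
      congr 1
      rw [add_sub_cancel_right] at h2
      exact h2.2.2
    have hne : i ≠ i + 1 := by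
      have : Nontrivial (Fin m) := Fin.nontrivial_iff_two_le.2 (by omega)
      simp [show m ≠ 1 by omega]
    have hcU := ncard_union_eq (hpart.2.1 _ _ hne) (hfin _ (hpart.subset _))
      (hfin _ (hpart.subset _))
    rw [hU]
    refine hsep _ _ (hP i).2.2 ((hP i).2.1.add (hP _).2.1) (by have := (hP i).1; omega) ?_
    rw [← hcU]
    refine hcard _ c (union_subset (hpart.subset _) (hpart.subset _)) ?_
    rw [disjoint_union_left]
    exact ⟨hpart.2.1 _ _ hc1.symm, hpart.2.1 _ _ hc2.symm⟩

/-- A circuit inside X keeps |X| from being the minimum, and a cocircuit outside X keeps r(M) from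
being it. -/
theorem HasTruncLiftRank.rk_eq_add_one [M.Finite] (hN : HasTruncLiftRank N M) {X C D : Set α}
    (hX : X ⊆ M.E) (hC : M.IsCircuit C) (hCX : C ⊆ X) (hD : M.IsCocircuit D)
    (hXD : Disjoint X D) : rk N X = rk M X + 1 := by
  have h1 := rk_lt_ncard (hC.dep.superset hCX hX)
  have h2 := rk_add_one_le_of_isCocircuit hD hX hXD hX
    (by rw [inter_eq_right.2 hD.subset_ground]; exact hD.nonempty)
  rw [hN.2 X hX]
  omega

theorem HasTruncLiftRank.conn_eq_add_two [M.Finite] (hN : HasTruncLiftRank N M)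
    {X C D C' D' : Set α} (hX : X ⊆ M.E) (hC : M.IsCircuit C) (hCX : C ⊆ X)
    (hD : M.IsCocircuit D) (hDX : D ⊆ X) (hC' : M.IsCircuit C') (hCX' : Disjoint X C')
    (hD' : M.IsCocircuit D') (hDX' : Disjoint X D') : conn N X = conn M X + 2 := by
  rw [conn, conn, hN.1, hN.rk_ground, hN.rk_eq_add_one hX hC hCX hD' hDX',
    hN.rk_eq_add_one sdiff_subset hC' (subset_sdiff.2 ⟨hC'.subset_ground, hCX'.symm⟩) hD
      (disjoint_sdiff_left.mono_right hDX)]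
  ring

/-- Flowers under the Higgs lift of the truncation. -/
theorem flower_truncLift {t : ℕ} (ht : 2 ≤ t) (hte : Even t)
    (hn : 2 * t + 2 ≤ n) (h : IsTCyclicOrdering t M σ) {m : ℕ} [NeZero m] {P : Fin m → Set α}
    (hP : IsEvenConcatenation t σ P) (hPt : ∀ i, t ≤ (P i).ncard) :
    IsFlower (t - 1) M P ∧ IsFlower (t + 1) (truncLift M) P ∧
      (4 ≤ m → ∀ i j, rk (truncLift M) (P i) = rk M (P i) + 1 ∧
        rk (truncLift M) (P i ∪ P j) = rk M (P i ∪ P j) + 1) ∧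
      (IsAnemone (t - 1) M P → IsAnemone (t + 1) (truncLift M) P) ∧
      (IsDaisy (t - 1) M P → IsDaisy (t + 1) (truncLift M) P) := by
  have := h.1.finite
  obtain ⟨v, hv⟩ := (h.even_card ht hn).two_dvd
  obtain ⟨s, rfl⟩ := hte.two_dvd
  obtain ⟨u, rfl⟩ := Nat.exists_eq_add_of_le' (show 1 ≤ s by omega)
  have hW := (h.hasWindows ht hn).1
  obtain ⟨hn0, hσ, hE⟩ := h.1
  have hN := hasTruncLiftRank_truncLift hW.one_le_rk
  have hW' := hW.truncLift hσ hE ht hn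
  have hF := isFlower_of_isEvenConcatenation hσ hE hv (by omega) hW hP
  have hP' : IsEvenConcatenation (2 * (u + 1) + 2) σ P := by
    obtain ⟨k, hk, hP⟩ := hP
    exact ⟨k, hk, fun i ↦ ⟨by have := hPt i; omega, (hP i).2⟩⟩
  have hF' : IsFlower (2 * (u + 1) + 1) (truncLift M) P :=
    isFlower_of_isEvenConcatenation hσ (by rw [hE, truncLift_ground]) hv (by omega) hW' hP'
  have hpart := hF.1
  -- Since t is even, the first t elements of a petal, which starts at an odd subscript, form both a
  -- circuit and a cocircuit.
  have hCD : ∀ i, ∃ C ⊆ P i, M.IsCircuit C ∧ M.IsCocircuit C := by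
    intro i
    obtain ⟨k, hk, hP⟩ := hP
    refine ⟨window σ (k (i - 1)) (2 * (u + 1)), ?_, hW.1 _ ?_, hW.2 _ ?_⟩
    · rw [(hk.eq_window hσ i).2.2]
      exact window_subset_window le_rfl (by have := hPt i; omega)
    · exact (hP i).2.2.add_odd odd_one
    · exact ((hP i).2.2.add_odd odd_one).add (even_two_mul _)
  choose C hCP hC hD using hCD
  have hrk : ∀ (I : Set (Fin m)) (a c : Fin m), a ∈ I → c ∉ I →
      rk (truncLift M) (⋃ i ∈ I, P i) = rk M (⋃ i ∈ I, P i) + 1 := fun I a c ha hc ↦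
    hN.rk_eq_add_one (hpart.biUnion_subset I) (hC a)
      ((hCP a).trans (subset_biUnion_of_mem (u := P) ha)) (hD c)
      ((hpart.disjoint_biUnion hc).mono_right (hCP c))
  have hconn : ∀ I : Set (Fin m), I.Nonempty → I ≠ univ →
      conn (truncLift M) (⋃ i ∈ I, P i) = conn M (⋃ i ∈ I, P i) + 2 := by
    rintro I ⟨a, ha⟩ hI
    obtain ⟨c, hc⟩ := (ne_univ_iff_exists_notMem I).1 hI
    have h1 := (hCP a).trans (subset_biUnion_of_mem (u := P) ha)
    have h2 := (hpart.disjoint_biUnion hc).mono_right (hCP c)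
    exact hN.conn_eq_add_two (hpart.biUnion_subset I) (hC a) h1 (hD a) h1 (hC c) h2 (hD c) h2
  -- The increase by 2 in connectivity is exactly the increase in the separation order, so both
  -- directions transfer; daisies need the equivalence.
  have hsep : ∀ I : Set (Fin m), I.Nonempty → I ≠ univ →
      (ExactlySeparating (truncLift M) (2 * (u + 1) + 1) (⋃ i ∈ I, P i) ↔
        ExactlySeparating M (2 * (u + 1) - 1) (⋃ i ∈ I, P i)) := fun I h1 h2 ↦ by
    rw [ExactlySeparating, ExactlySeparating, hconn I h1 h2]
    omega
  refine ⟨hF, hF', fun hm i j ↦ ?_, fun hA ↦ ⟨hF', fun I h1 h2 ↦ ?_⟩,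
    fun hA ↦ ⟨hF', fun I h1 h2 ↦ ?_⟩⟩
  · obtain ⟨c, hc1, hc2⟩ := exists_ne_ne (by omega) i j
    have h1 := hrk {i} i c rfl hc1
    have h2 := hrk {i, j} i c (by simp) (by simp [hc1, hc2])
    simp only [biUnion_pair, biUnion_singleton] at h1 h2
    exact ⟨h1, h2⟩
  · exact (hsep I h1 h2).2 (hA.2 I h1 h2)
  · rw [hsep I h1 h2]
    exact hA.2 I h1 h2

end Flower


/-! ### Iterating the construction -/

section Iterate

variable {α : Type*} {n : ℕ} {σ : ZMod n → α} {M : Matroid α} {t : ℕ}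

theorem IsEvenConcatenation.of_add_two {m : ℕ} [NeZero m] {P : Fin m → Set α}
    (h : IsEvenConcatenation (t + 2) σ P) :
    IsEvenConcatenation t σ P ∧ ∀ i, t ≤ (P i).ncard := by
  obtain ⟨k, hk, hP⟩ := h
  have : ∀ i, t ≤ (P i).ncard := fun i ↦ by have := (hP i).1; omega
  exact ⟨⟨k, hk, fun i ↦ ⟨by have := this i; omega, (hP i).2⟩⟩, this⟩

/-- The size bound is what the last application needs, namely 2(t + 2(k - 1)) + 2 ≤ n. Even
concatenations for t + 2 are those for t whose petals have at least t elements, the case in which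
flowers are transferred. -/
theorem iterate_truncLift (ht : 2 ≤ t) (hte : Even t) (h : IsEvenTCyclicOrdering t M σ) (k : ℕ)
    (hk : 2 * t + 4 * k ≤ n + 2) :
    IsEvenTCyclicOrdering (t + 2 * k) (truncLift^[k] M) σ ∧
      ((∀ (m : ℕ) [NeZero m] (P : Fin m → Set α),
          IsEvenConcatenation t σ P → IsAnemone (t - 1) M P) →
        ∀ (m : ℕ) [NeZero m] (P : Fin m → Set α),
          IsEvenConcatenation (t + 2 * k) σ P →
            IsAnemone (t + 2 * k - 1) (truncLift^[k] M) P) ∧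
      ((∀ (m : ℕ) [NeZero m] (P : Fin m → Set α),
          IsEvenConcatenation t σ P → IsDaisy (t - 1) M P) →
        ∀ (m : ℕ) [NeZero m] (P : Fin m → Set α),
          IsEvenConcatenation (t + 2 * k) σ P →
            IsDaisy (t + 2 * k - 1) (truncLift^[k] M) P) := by
  induction k with
  | zero => exact ⟨h, fun h ↦ h, fun h ↦ h⟩
  | succ k ih =>
    obtain ⟨h1, h2, h3⟩ := ih (by omega)
    rw [Function.iterate_succ_apply', show t + 2 * (k + 1) = t + 2 * k + 2 by ring]
    have hn : 2 * (t + 2 * k) + 2 ≤ n := by omega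
    refine ⟨(isTCyclicOrdering_truncLift h1.1 (by omega) hn).2.2 h1, fun hA m _ P hP ↦ ?_,
      fun hA m _ P hP ↦ ?_⟩
    · obtain ⟨hP1, hP2⟩ := hP.of_add_two
      exact (flower_truncLift (by omega) (hte.add (even_two_mul k)) hn h1.1 hP1 hP2).2.2.2.1
        (h2 hA m P hP1)
    · obtain ⟨hP1, hP2⟩ := hP.of_add_two
      exact (flower_truncLift (by omega) (hte.add (even_two_mul k)) hn h1.1 hP1 hP2).2.2.2.2
        (h3 hA m P hP1)

end Iterate

/-! ### Petals as unions of pairs -/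

section Pairs

theorem biUnion_petals {α ι : Type*} {m : ℕ} {P : Fin m → Set α} {Q : ι → Set α} {p : ι → Fin m}
    (h : ∀ i, P i = ⋃ j ∈ p ⁻¹' {i}, Q j) (I : Set (Fin m)) :
    ⋃ i ∈ I, P i = ⋃ j ∈ p ⁻¹' I, Q j := by
  ext x
  simp only [h, mem_iUnion, mem_preimage, mem_singleton_iff, exists_prop]
  constructor
  · rintro ⟨_, hi, j, rfl, hx⟩
    exact ⟨j, hi, hx⟩
  · rintro ⟨j, hj, hx⟩
    exact ⟨_, hj, j, rfl, hx⟩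

theorem Fin.ofNat_add_ofNat {m : ℕ} [NeZero m] (a b : ℕ) :
    Fin.ofNat m (a + b) = Fin.ofNat m a + Fin.ofNat m b := by
  ext
  simp [Fin.val_add, Nat.add_mod]

theorem Fin.ofNat_one_eq {m : ℕ} [NeZero m] : Fin.ofNat m 1 = 1 := rfl

variable {α : Type*} {r m : ℕ} [NeZero r] {σ : ZMod (2 * r) → α}

theorem exists_window_eq_pair {i : ℕ} (hi : Odd i) : ∃ j : Fin r,
    window σ i 2 = window σ (2 * (j : ℕ) + 1) 2 ∧
      window σ (i + 2) 2 = window σ (2 * ((j + 1 : Fin r) : ℕ) + 1) 2 := by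
  obtain ⟨a, rfl⟩ := hi
  have key : ∀ b : ℕ, window σ (2 * b + 1) 2 = window σ (2 * (Fin.ofNat r b : ℕ) + 1) 2 :=
    fun b ↦ window_congr (((Nat.mod_modEq b r).symm.mul_left' 2).add_right 1)
  refine ⟨Fin.ofNat r a, key a, ?_⟩
  rw [← Fin.ofNat_one_eq, ← Fin.ofNat_add_ofNat, ← key]
  ring_nf

variable [NeZero m] {t : ℕ} {P : Fin m → Set α}

theorem val_sub_one_cases (j : Fin r) : ((j : ℕ) = 0 ∧ ((j - 1 : Fin r) : ℕ) = r - 1) ∨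
    ((j : ℕ) ≠ 0 ∧ ((j - 1 : Fin r) : ℕ) = j - 1) := by
  by_cases h : j = 0
  · subst h
    exact Or.inl ⟨by simp, Fin.val_zero_sub_one⟩
  · exact Or.inr ⟨fun h0 ↦ h (Fin.ext h0), Fin.val_sub_one h⟩

/-- The map `p` sends a pair to the petal that contains it, and `s` sends a petal to its first
pair. -/
theorem IsEvenConcatenation.exists_petal_maps (hσ : Function.Injective σ)
    (hP : IsEvenConcatenation t σ P) : ∃ (p : Fin r → Fin m) (s : Fin m → Fin r),
      (∀ i, P i = ⋃ j ∈ p ⁻¹' {i}, window σ (2 * (j : ℕ) + 1) 2) ∧ (∀ i, p (s i) = i) ∧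
      (∀ i, p (s i - 1) = i - 1) ∧ ∀ j, j ≠ s (p j) → p (j - 1) = p j := by
  obtain ⟨k, hk, hodd⟩ := hP
  have hr : 0 < r := NeZero.pos r
  have hodd : ∀ i, k i % 2 = 1 := fun i ↦ by
    have := (hodd (i + 1)).2.2
    rwa [add_sub_cancel_right, Nat.odd_iff] at this
  have hpart := hk.isPartition hσ (by omega)
  obtain ⟨hmono, hb, hP⟩ := hk
  have hmem : ∀ j : Fin r, 2 * (j : ℕ) + 1 ∈ Icc 1 (2 * r) := fun j ↦
    ⟨by omega, by have := j.2; omega⟩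
  choose p hp hp' using fun j : Fin r ↦ existsUnique_mem_cyclicInterval hmono hb (hmem j)
  replace hp : ∀ j : Fin r, 2 * (j : ℕ) + 1 ∈ cyclicInterval (2 * r) (k (p j - 1)) (k (p j) - 1) :=
    hp
  replace hp' : ∀ (j : Fin r) (i : Fin m),
      2 * (j : ℕ) + 1 ∈ cyclicInterval (2 * r) (k (i - 1)) (k i - 1) → i = p j := hp'
  have hs : ∀ i, (k (i - 1) - 1) / 2 < r := fun i ↦ by have := hb (i - 1); omega
  let s : Fin m → Fin r := fun i ↦ ⟨(k (i - 1) - 1) / 2, hs i⟩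
  -- Petals begin at odd subscripts, so no boundary separates 2j + 1 from 2j + 2.
  have hsub : ∀ j : Fin r, window σ (2 * (j : ℕ) + 1) 2 ⊆ P (p j) := by
    intro j
    rw [hP (p j)]
    rintro _ ⟨x, ⟨hx1, hx2⟩, rfl⟩
    refine ⟨x, ?_, rfl⟩
    have h1 := hp j
    have h2 := hodd (p j - 1)
    have h3 := hodd (p j)
    have h4 := j.2
    unfold cyclicInterval at h1 ⊢
    split_ifs at h1 ⊢ with h
    · rw [mem_Icc] at h1 ⊢
      omega
    · simp only [mem_union, mem_Icc] at h1 ⊢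
      omega
  refine ⟨p, s, fun i ↦ subset_antisymm (fun y hy ↦ ?_) ?_, fun i ↦ (hp' _ _ ?_).symm,
    fun i ↦ (hp' _ _ ?_).symm, fun j hj ↦ (hp' _ _ ?_).symm⟩
  · have hyr : y ∈ window σ 1 (2 * r) := by
      rw [window_self (by omega)]
      exact hpart.subset i hy
    obtain ⟨x, ⟨hx1, hx2⟩, rfl⟩ := hyr
    let j : Fin r := ⟨(x - 1) / 2, by omega⟩
    have hxj : σ (x : ZMod (2 * r)) ∈ window σ (2 * (j : ℕ) + 1) 2 :=
      mem_window (by simp only [j]; omega) (by simp only [j]; omega)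
    refine mem_iUnion₂.2 ⟨j, ?_, hxj⟩
    by_contra hne
    exact disjoint_left.1 (hpart.2.1 (p j) i hne) (hsub j hxj) hy
  · refine iUnion₂_subset fun j hj ↦ ?_
    rw [← show p j = i from hj]
    exact hsub j
  · have h1 := hb (i - 1)
    have h2 := hodd (i - 1)
    have h3 : 2 * ((s i : Fin r) : ℕ) + 1 = k (i - 1) := by simp only [s]; omega
    rw [h3]
    unfold cyclicInterval
    split_ifs with h
    · exact ⟨le_rfl, h⟩
    · exact Or.inl ⟨le_rfl, h1.2⟩
  · have h1 := hb (i - 1)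
    have h2 := hodd (i - 1)
    have h3 : 2 * ((s i : Fin r) : ℕ) + 1 = k (i - 1) := by simp only [s]; omega
    have h4 := hb (i - 1 - 1)
    have h5 := hodd (i - 1 - 1)
    have h6 := val_sub_one_cases (s i)
    unfold cyclicInterval
    split_ifs with h
    · rw [mem_Icc]
      omega
    · simp only [mem_union, mem_Icc]
      omega
  · have h1 := hb (p j - 1)
    have h2 := hodd (p j - 1)
    have h3 : 2 * ((s (p j) : Fin r) : ℕ) + 1 = k (p j - 1) := by simp only [s]; omega
    have h4 : (j : ℕ) ≠ s (p j) := fun h ↦ hj (Fin.ext h)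
    have h6 := val_sub_one_cases j
    have h7 := hp j
    have h8 := j.2
    unfold cyclicInterval at h7 ⊢
    split_ifs at h7 ⊢ with h
    · rw [mem_Icc] at h7 ⊢
      omega
    · simp only [mem_union, mem_Icc] at h7 ⊢
      omega

theorem isAnemone_of_forall {M : Matroid α} {k : ℕ} (hP : IsPartition P M.E)
    (h : ∀ I : Set (Fin m), I.Nonempty → I ≠ univ → ExactlySeparating M k (⋃ i ∈ I, P i)) :
    IsAnemone k M P := by
  refine ⟨⟨hP, fun hm i ↦ ?_, fun hm i ↦ ?_⟩, h⟩
  · obtain ⟨c, hc⟩ : ∃ c, c ≠ i := by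
      have : Nontrivial (Fin m) := Fin.nontrivial_iff_two_le.2 hm
      exact exists_ne i
    have := h {i} (singleton_nonempty i) ((ne_univ_iff_exists_notMem _).2 ⟨c, by simpa using hc⟩)
    simpa using this
  · obtain ⟨c, hc1, hc2⟩ := exists_ne_ne hm i (i + 1)
    have := h {i, i + 1} (insert_nonempty _ _)
      ((ne_univ_iff_exists_notMem _).2 ⟨c, by simp [hc1, hc2]⟩)
    rwa [biUnion_pair] at this

end Pairs

/-! ### Consecutive sets -/

section Consecutive

variable {m : ℕ} [NeZero m] {I : Set (Fin m)}

/-- The elements that directly follow a maximal run of consecutive members of `I`. -/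
def runEnds (I : Set (Fin m)) : Set (Fin m) := {i | i ∉ I ∧ i - 1 ∈ I}

theorem Fin.exists_eq_add_ofNat (x y : Fin m) : ∃ d < m, y = x + Fin.ofNat m d := by
  refine ⟨(y - x).val, (y - x).2, ?_⟩
  have : Fin.ofNat m (y - x).val = y - x := by ext; simp
  rw [this, add_sub_cancel]

theorem runEnds_nonempty (h : I.Nonempty) (h' : I ≠ univ) : (runEnds I).Nonempty := by
  by_contra hne
  rw [not_nonempty_iff_eq_empty, eq_empty_iff_forall_notMem] at hne
  obtain ⟨x, hx⟩ := h
  have key : ∀ d : ℕ, x + Fin.ofNat m d ∈ I := by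
    intro d
    induction d with
    | zero => simpa using hx
    | succ d ih =>
      by_contra hd
      refine hne _ ⟨hd, ?_⟩
      rwa [Fin.ofNat_add_ofNat, Fin.ofNat_one_eq, ← add_assoc, add_sub_cancel_right]
  refine h' (eq_univ_of_forall fun y ↦ ?_)
  obtain ⟨d, -, rfl⟩ := Fin.exists_eq_add_ofNat x y
  exact key d

/-- Each maximal cyclic run of a nonempty proper set has exactly one end, so `runEnds` counts runs.
This makes consecutiveness comparable with connectivity. -/
theorem isConsecutive_iff_ncard_runEnds (h : I.Nonempty) (h' : I ≠ univ) :
    IsConsecutive I ↔ (runEnds I).ncard = 1 := by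
  classical
  rw [ncard_eq_one]
  constructor
  · rintro ⟨a, l, hI⟩
    refine ⟨a + Fin.ofNat m l, (subset_singleton_iff_eq.1 ?_).resolve_left
      (runEnds_nonempty h h').ne_empty⟩
    rintro i ⟨hi, hi'⟩
    have hi2 : i ∉ (fun j : ℕ ↦ a + Fin.ofNat m j) '' Iio l := fun hh ↦ hi (hI ▸ hh)
    rw [hI] at hi'
    obtain ⟨j, hj, hji⟩ := hi'
    have hj1 : a + Fin.ofNat m (j + 1) = i := by
      rw [Fin.ofNat_add_ofNat, Fin.ofNat_one_eq, ← add_assoc, eq_sub_iff_add_eq.1 hji]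
    have hjl : ¬ j + 1 < l := fun hlt ↦ hi2 ⟨j + 1, hlt, hj1⟩
    have hj2 : j < l := hj
    rw [mem_singleton_iff, ← hj1, show j + 1 = l by omega]
  · rintro ⟨i₀, hi₀⟩
    have hmem : i₀ ∈ runEnds I := hi₀ ▸ mem_singleton i₀
    have hm : 1 ≤ m - 1 := by
      have h0 := NeZero.pos m
      by_contra hm
      have : m = 1 := by omega
      subst this
      exact hmem.1 (by convert hmem.2 using 1)
    let p : ℕ → Prop := fun d ↦ i₀ - Fin.ofNat m d ∈ I
    have hp1 : p 1 := by simpa only [p, Fin.ofNat_one_eq] using hmem.2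
    set l := Nat.findGreatest p (m - 1) with hl
    have hl1 : 1 ≤ l := Nat.le_findGreatest hm hp1
    have hlm : l ≤ m - 1 := Nat.findGreatest_le _
    have hpl : p l := Nat.findGreatest_spec hm hp1
    -- A gap in the walk backwards from i₀ would be a second run end; it differs from i₀ because
    -- fewer than m steps were taken.
    have hdown : ∀ d, p (d + 2) → d + 2 ≤ m - 1 → p (d + 1) := by
      intro d hd hdm
      by_contra hnd
      have hmem' : i₀ - Fin.ofNat m (d + 1) ∈ runEnds I := by
        refine ⟨hnd, ?_⟩
        rw [sub_sub, ← Fin.ofNat_one_eq, ← Fin.ofNat_add_ofNat]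
        exact hd
      rw [hi₀, mem_singleton_iff, sub_eq_self] at hmem'
      have := congrArg Fin.val hmem'
      simp only [Fin.val_ofNat, Fin.val_zero] at this
      rw [Nat.mod_eq_of_lt (by omega)] at this
      omega
    have hall : ∀ e, ∀ d, 1 ≤ d → d + e = l → p d := by
      intro e
      induction e with
      | zero => rintro d - rfl; exact hpl
      | succ e ih =>
        intro d hd hde
        obtain ⟨d, rfl⟩ := Nat.exists_eq_add_of_le' hd
        exact hdown d (ih (d + 2) (by omega) (by omega)) (by omega)
    have hsub : ∀ j, j ≤ l →
        i₀ - Fin.ofNat m l + Fin.ofNat m j = i₀ - Fin.ofNat m (l - j) := by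
      intro j hj
      conv_lhs => rw [← Nat.sub_add_cancel hj, Fin.ofNat_add_ofNat]
      abel
    refine ⟨i₀ - Fin.ofNat m l, l, subset_antisymm (fun x hx ↦ ?_) ?_⟩
    · obtain ⟨d, hdm, hd⟩ := Fin.exists_eq_add_ofNat x i₀
      have hxd : x = i₀ - Fin.ofNat m d := by rw [hd, add_sub_cancel_right]
      have hd0 : d ≠ 0 := by
        rintro rfl
        have : x = i₀ := by simpa using hxd
        exact hmem.1 (this ▸ hx)
      have hdl : d ≤ l := Nat.le_findGreatest (by omega) (by rw [hxd] at hx; exact hx)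
      refine ⟨l - d, by simp only [mem_Iio]; omega, ?_⟩
      simp only
      rw [hsub _ (by omega), hxd, Nat.sub_sub_self hdl]
    · rintro _ ⟨j, hj, rfl⟩
      have hj' : j < l := hj
      simp only
      rw [hsub j hj'.le]
      exact hall j (l - j) (by omega) (by omega)

/-- Membership can change only at the first pair of a petal. Hence petals and pairs have the same
number of runs, and petal unions can be analysed pair by pair. -/
theorem runEnds_preimage {r : ℕ} [NeZero r] {p : Fin r → Fin m} {s : Fin m → Fin r}
    (h1 : ∀ i, p (s i) = i) (h2 : ∀ i, p (s i - 1) = i - 1)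
    (h3 : ∀ j, j ≠ s (p j) → p (j - 1) = p j) : runEnds (p ⁻¹' I) = s '' runEnds I := by
  ext j
  constructor
  · rintro ⟨hj, hj'⟩
    have hjs : j = s (p j) := by
      by_contra hne
      rw [mem_preimage, h3 j hne] at hj'
      exact hj hj'
    refine ⟨p j, ⟨hj, ?_⟩, hjs.symm⟩
    rw [← h2, ← hjs]
    exact hj'
  · rintro ⟨i, ⟨hi, hi'⟩, rfl⟩
    exact ⟨by rwa [mem_preimage, h1], by rwa [mem_preimage, h2]⟩

theorem ncard_runEnds_preimage {r : ℕ} [NeZero r] {p : Fin r → Fin m} {s : Fin m → Fin r}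
    (h1 : ∀ i, p (s i) = i) (h2 : ∀ i, p (s i - 1) = i - 1)
    (h3 : ∀ j, j ≠ s (p j) → p (j - 1) = p j) :
    (runEnds (p ⁻¹' I)).ncard = (runEnds I).ncard := by
  rw [runEnds_preimage h1 h2 h3,
    ncard_image_of_injective _ (Function.LeftInverse.injective (g := p) h1)]

end Consecutive


/-! ### Pairs whose unions are circuits and cocircuits -/

section PairPartition

variable {α : Type*} {M : Matroid α} {r : ℕ} {L : Fin r → Set α} {σ : ZMod (2 * r) → α}

theorem hasWindows_four_of_listsPairs [NeZero r] (hL : ListsPairs σ L)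
    (h : ∀ j, M.IsCircuit (L j ∪ L (j + 1)) ∧ M.IsCocircuit (L j ∪ L (j + 1))) :
    HasWindows 4 M σ 1 := by
  have key : ∀ i, Even (i + 1) →
      M.IsCircuit (window σ i 4) ∧ M.IsCocircuit (window σ i 4) := fun i hi ↦ by
    obtain ⟨j, hj1, hj2⟩ := exists_window_eq_pair (σ := σ) (i := i)
      (by rw [Nat.odd_iff, Nat.even_iff] at *; omega)
    rw [show 4 = 2 + 2 from rfl, ← window_union, hj1, hj2, ← hL, ← hL]
    exact h j
  exact ⟨fun i hi ↦ (key i hi).1, fun i hi ↦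
    (key i (by rw [Nat.even_iff] at *; omega)).2⟩

theorem rk_of_ssubset_isCircuit [M.Finite] {X C : Set α} (hC : M.IsCircuit C) (hX : X ⊂ C) :
    rk M X = X.ncard :=
  (indep_iff_rk_eq (M.ground_finite.subset (hX.subset.trans hC.subset_ground))).1
    (hC.ssubset_indep hX)

theorem rk_compl_of_ssubset_isCocircuit [M.Finite] {X D : Set α} (hD : M.IsCocircuit D)
    (hX : X ⊂ D) : rk M (M.E \ X) = rk M M.E := by
  have h1 := rk_of_ssubset_isCircuit (M := M✶) hD hX
  rw [rk_dual (hX.subset.trans hD.subset_ground)] at h1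
  linarith

theorem IsPairPartition.ncard_union {E : Set α} (h : IsPairPartition L E) {i j : Fin r}
    (hij : i ≠ j) : (L i ∪ L j).ncard = 4 := by
  have hf : ∀ i, (L i).Finite := fun i ↦ finite_of_ncard_ne_zero (by rw [h.2 i]; decide)
  rw [ncard_union_eq (h.1.2.1 i j hij) (hf i) (hf j), h.2, h.2]

theorem IsPairPartition.left_ssubset_union {E : Set α} (h : IsPairPartition L E) {i j : Fin r}
    (hij : i ≠ j) : L i ⊂ L i ∪ L j :=
  subset_union_left.ssubset_of_ne fun heq ↦ by
    have h1 := h.ncard_union hij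
    rw [← heq, h.2] at h1
    omega

end PairPartition

/-! ### Spikes -/

section Spike

variable {α : Type*} {M : Matroid α} {r : ℕ} {L : Fin r → Set α} {σ : ZMod (2 * r) → α}

/-- The pairs of a spike play symmetric roles, so they may be renumbered in the order in which σ
lists them. -/
theorem IsSpike.comp_perm (h : IsSpike r M L) (π : Equiv.Perm (Fin r)) :
    IsSpike r M fun i ↦ L (π i) := by
  obtain ⟨hr, ⟨⟨h1, h2, h3⟩, h4⟩, h5⟩ := h
  refine ⟨hr, ⟨⟨fun i ↦ h1 _, fun i j hij ↦ h2 _ _ (π.injective.ne hij), ?_⟩, fun i ↦ h4 _⟩,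
    fun i j hij ↦ h5 _ _ (π.injective.ne hij)⟩
  rw [← h3]
  exact π.surjective.iUnion_comp L

/-- Adding a pair `L a` raises the rank by at most one through the circuit `L a ∪ L b` with b
already in J, and by at least one through the cocircuit `L a ∪ L c` with c still outside. -/
theorem IsSpike.rk_biUnion [M.Finite] (h : IsSpike r M L) {J : Finset (Fin r)}
    (hJ : J.Nonempty) (hJ' : J ≠ Finset.univ) : rk M (⋃ j ∈ J, L j) = J.card + 1 := by
  obtain ⟨hr, hL, h⟩ := h
  have hLE := hL.1.subset
  induction hJ using Finset.Nonempty.cons_induction with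
  | singleton a =>
    obtain ⟨b, hb, -⟩ := exists_ne_ne hr a a
    have := rk_of_ssubset_isCircuit (h a b hb.symm).1.1 (hL.left_ssubset_union hb.symm)
    rw [hL.2] at this
    simpa using this
  | cons a J ha hJ ih =>
    rw [Finset.cons_eq_insert] at hJ' ⊢
    have ih := ih (fun hu ↦ ha (hu ▸ Finset.mem_univ a))
    obtain ⟨b, hb⟩ := hJ
    obtain ⟨c, hc⟩ : ∃ c, c ∉ insert a J := by
      by_contra! hall
      exact hJ' (Finset.eq_univ_iff_forall.2 hall)
    rw [Finset.mem_insert, not_or] at hc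
    rw [Finset.card_insert_of_notMem ha, Finset.set_biUnion_insert]
    have hab : a ≠ b := fun hab ↦ ha (hab ▸ hb)
    have hXE : (⋃ j ∈ J, L j) ⊆ M.E := iUnion₂_subset fun j _ ↦ hLE j
    have h1 := rk_inter_add_rk_union_le M (⋃ j ∈ J, L j) (L a ∪ L b)
    have hbJ : L b ⊆ ⋃ j ∈ J, L j := subset_biUnion_of_mem (u := L) (Finset.mem_coe.2 hb)
    have h2 : L b ⊆ (⋃ j ∈ J, L j) ∩ (L a ∪ L b) := subset_inter hbJ subset_union_right
    have h3 := rk_mono (M := M) h2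
    have h4 := rk_of_ssubset_isCircuit (h b a hab.symm).1.1 (hL.left_ssubset_union hab.symm)
    have h5 := rk_eq_of_isCircuit (h a b hab).1.1
    have h6 : (L a ∪ ⋃ j ∈ J, L j) ⊆ (⋃ j ∈ J, L j) ∪ (L a ∪ L b) :=
      union_subset (subset_union_left.trans subset_union_right) subset_union_left
    have h7 := rk_mono (M := M) h6
    rw [hL.2] at h4
    rw [hL.ncard_union hab] at h5
    have h8 := rk_add_one_le_of_isCocircuit (h a c (Ne.symm hc.1)).2.1 hXE
      (Y := L a ∪ ⋃ j ∈ J, L j) (by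
        rw [disjoint_union_right]
        simp only [disjoint_iUnion_left]
        exact ⟨fun j hj ↦ hL.1.2.1 _ _ (fun hja ↦ ha (hja ▸ hj)),
          fun j hj ↦ hL.1.2.1 _ _ (fun hjc ↦ hc.2 (hjc ▸ hj))⟩) subset_union_right (by
        obtain ⟨x, hx⟩ := hL.1.1 a
        exact ⟨x, Or.inl hx, Or.inl hx⟩)
    push_cast at *
    omega

theorem IsSpike.rk_ground [M.Finite] (h : IsSpike r M L) : rk M M.E = r := by
  have hr := h.1
  let a : Fin r := ⟨0, by omega⟩
  obtain ⟨b, hb, -⟩ := exists_ne_ne hr a a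
  have h1 := rk_compl_of_ssubset_isCocircuit (h.2.2 a b hb.symm).2.1
    (h.2.1.left_ssubset_union hb.symm)
  have h2 : M.E \ L a = ⋃ j ∈ (Finset.univ.erase a : Finset (Fin r)), L j := by
    have := h.2.1.1.diff_biUnion {a}
    rw [biUnion_singleton] at this
    rw [this]
    simp
  have hcard : (Finset.univ.erase a : Finset (Fin r)).card = r - 1 := by
    rw [Finset.card_erase_of_mem (Finset.mem_univ a), Finset.card_univ, Fintype.card_fin]
  rw [h2, h.rk_biUnion ⟨b, by simpa using hb⟩ (Finset.erase_ssubset (Finset.mem_univ a)).ne,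
    hcard] at h1
  omega

theorem IsSpike.conn_biUnion [M.Finite] (h : IsSpike r M L) {J : Set (Fin r)}
    (hJ : J.Nonempty) (hJ' : J ≠ univ) : conn M (⋃ j ∈ J, L j) = 2 := by
  rw [conn, h.2.1.1.diff_biUnion, h.rk_ground]
  lift J to Finset (Fin r) using J.toFinite
  have h1 := h.rk_biUnion (J := J) (by simpa using hJ) (by simpa using hJ')
  have h2 := h.rk_biUnion (J := Jᶜ)
    (by rw [Finset.nonempty_iff_ne_empty, Ne, Finset.compl_eq_empty_iff]; simpa using hJ')
    (by
      rw [Ne, Finset.compl_eq_univ_iff]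
      exact Finset.nonempty_iff_ne_empty.1 (by simpa using hJ))
  have h3 := J.card_add_card_compl
  rw [Fintype.card_fin] at h3
  have h4 : (⋃ j ∈ (Jᶜ : Finset (Fin r)), L j) = ⋃ j ∈ (J : Set (Fin r))ᶜ, L j := by simp
  rw [h4] at h2
  have h5 : (⋃ j ∈ (J : Set (Fin r)), L j) = ⋃ j ∈ J, L j := rfl
  rw [h5, h1, h2]
  omega

theorem IsSpike.isEvenTCyclicOrdering (h : IsSpike r M L) (hσ : IsCyclicOrdering σ M.E)
    (hL : ListsPairs σ L) : IsEvenTCyclicOrdering 4 M σ := by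
  have hr := h.1
  have : NeZero r := ⟨by omega⟩
  have hne : ∀ j : Fin r, j ≠ j + 1 := fun j ↦ by
    have : Nontrivial (Fin r) := Fin.nontrivial_iff_two_le.2 (by omega)
    simp [show r ≠ 1 by omega]
  have hW : HasWindows 4 M σ 1 := hasWindows_four_of_listsPairs hL fun j ↦
    ⟨(h.2.2 _ _ (hne j)).1.1, (h.2.2 _ _ (hne j)).2.1⟩
  exact (hW.isTCyclicOrdering hσ (by omega) (by omega)).2.2 (by decide)

theorem IsSpike.isAnemone (h : IsSpike r M L) (hσ : IsCyclicOrdering σ M.E)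
    (hL : ListsPairs σ L) {t m : ℕ} [NeZero m] {P : Fin m → Set α}
    (hP : IsEvenConcatenation t σ P) : IsAnemone 3 M P := by
  have hr := h.1
  have : NeZero r := ⟨by omega⟩
  have := hσ.finite
  obtain ⟨p, s, hp, hs, -⟩ := hP.exists_petal_maps hσ.2.1
  have hpart : IsPartition P M.E := by
    obtain ⟨k, hk, -⟩ := hP
    exact hσ.2.2 ▸ hk.isPartition hσ.2.1 hσ.1
  refine isAnemone_of_forall hpart fun I hI hI' ↦ ?_
  have hsurj : Function.Surjective p := fun i ↦ ⟨s i, hs i⟩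
  have h1 := h.conn_biUnion (J := p ⁻¹' I) (hI.preimage hsurj)
    (fun hu ↦ hI' (hsurj.preimage_injective (by rw [hu, preimage_univ])))
  simp only [hL _] at h1
  rw [ExactlySeparating, biUnion_petals hp, h1]
  norm_num

end Spike

/-! ### Swirls -/

section Swirl

theorem Fin.add_one_ne_self {r : ℕ} [NeZero r] (hr : 3 ≤ r) (j : Fin r) : j + 1 ≠ j := by
  have : Nontrivial (Fin r) := Fin.nontrivial_iff_two_le.2 (by omega)
  simp [show r ≠ 1 by omega]

theorem Fin.add_one_add_one_ne_self {r : ℕ} [NeZero r] (hr : 3 ≤ r) (j : Fin r) :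
    j + 1 + 1 ≠ j := by
  intro h
  rw [add_assoc, add_eq_left] at h
  have := congrArg Fin.val h
  rw [← Fin.ofNat_one_eq, ← Fin.ofNat_add_ofNat, Fin.val_ofNat, Nat.mod_eq_of_lt (by omega)] at this
  simp at this

theorem rk_insert_of_notMem_closure {α : Type*} {M : Matroid α} [M.Finite] {e : α} {X : Set α}
    (he : e ∈ M.E) (h : e ∉ M.closure X) : rk M (insert e X) = rk M X + 1 := by
  have h1 := Matroid.eRk_insert_eq_add_one (M := M) ⟨he, h⟩
  rw [← natCast_toNat_eRk M, ← natCast_toNat_eRk M X] at h1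
  unfold rk
  exact_mod_cast h1

variable {α : Type*} {r : ℕ} [NeZero r] {M : Matroid α} {L : Fin r → Set α}
  {M₀ : Matroid (α ⊕ Fin r)} {σ : ZMod (2 * r) → α}

/-- The indices of the joints that lie in the span of the pairs indexed by `J`. -/
def jointSet (J : Set (Fin r)) : Set (Fin r) := {v | v ∈ J ∨ v - 1 ∈ J}

/-- `M₀` shows that `M` is a swirl with pairs `L`. -/
structure IsSwirlExtension (M : Matroid α) (L : Fin r → Set α) (M₀ : Matroid (α ⊕ Fin r)) :
    Prop where
  three_le : 3 ≤ r
  pairs : IsPairPartition L M.E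
  ground : M₀.E = Sum.inl '' M.E ∪ range Sum.inr
  simple : IsSimple M₀
  isBase : M₀.IsBase (range Sum.inr)
  subset_closure : ∀ i, Sum.inl '' L i ⊆ M₀.closure {Sum.inr i, Sum.inr (i + 1)}
  eq_delete : M = (M₀.delete (range Sum.inr)).comap Sum.inl

namespace IsSwirlExtension

variable (h : IsSwirlExtension M L M₀)

include h

theorem finite [M.Finite] : M₀.Finite :=
  ⟨by rw [h.ground]; exact (M.ground_finite.image _).union (finite_range _)⟩

theorem rk_eq {X : Set α} (hX : X ⊆ M.E) : rk M X = rk M₀ (Sum.inl '' X) := by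
  have hsub : (Sum.inl '' X : Set (α ⊕ Fin r)) ⊆ M₀.E \ range Sum.inr := by
    rintro _ ⟨x, hx, rfl⟩
    refine ⟨?_, by simp⟩
    rw [h.ground]
    exact Or.inl ⟨x, hX hx, rfl⟩
  conv_lhs => rw [h.eq_delete]
  rw [rk, rk, Matroid.eRk_comap, Matroid.delete_eq_restrict, Matroid.restrict_eRk_eq _ hsub]

theorem indep_joints (S : Set (Fin r)) : M₀.Indep (Sum.inr '' S) :=
  h.isBase.indep.subset (image_subset_range _ _)

theorem rk_joints [M₀.Finite] (S : Set (Fin r)) : rk M₀ (Sum.inr '' S) = S.ncard := by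
  rw [(indep_iff_rk_eq (S.toFinite.image _)).1 (h.indep_joints S),
    ncard_image_of_injective _ Sum.inr_injective]

theorem mem_ground {e : α} (he : e ∈ M.E) : Sum.inl e ∈ M₀.E := by
  rw [h.ground]
  exact Or.inl ⟨e, he, rfl⟩

theorem joint_mem_ground (v : Fin r) : Sum.inr v ∈ M₀.E := by
  rw [h.ground]
  exact Or.inr ⟨v, rfl⟩

/-- Simplicity makes `L i` independent of size 2 inside a line of rank 2, so it spans that line. -/
theorem closure_pair [M₀.Finite] (i : Fin r) :
    M₀.closure (Sum.inl '' L i) = M₀.closure (Sum.inr '' {i, i + 1}) := by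
  have hsub : Sum.inl '' L i ⊆ M₀.closure (Sum.inr '' {i, i + 1}) := by
    rw [image_pair]
    exact h.subset_closure i
  rw [← Matroid.closure_closure M₀ (Sum.inr '' {i, i + 1})]
  refine (M₀.isRkFinite_set _).closure_eq_closure_of_subset_of_eRk_ge_eRk hsub ?_
  rw [Matroid.eRk_closure_eq, ← rk_le_rk_iff, h.rk_joints,
    ncard_pair (Fin.add_one_ne_self h.three_le i).symm]
  obtain ⟨e, f, hef, hL⟩ := ncard_eq_two.1 (h.pairs.2 i)
  have hLE := h.pairs.1.subset i
  rw [hL] at hLE ⊢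
  have hind := h.simple _ (h.mem_ground (hLE (mem_insert e _))) _
    (h.mem_ground (hLE (mem_insert_of_mem e rfl)))
  rw [image_pair, (indep_iff_rk_eq (by simp)).1 hind,
    ncard_pair (Sum.inl_injective.ne hef)]

theorem closure_biUnion [M₀.Finite] (J : Set (Fin r)) :
    M₀.closure (Sum.inl '' ⋃ j ∈ J, L j) = M₀.closure (Sum.inr '' jointSet J) := by
  have h1 : Sum.inr '' jointSet J =
      (⋃ j ∈ J, Sum.inr '' {j, j + 1} : Set (α ⊕ Fin r)) := by
    rw [← image_iUnion₂]
    congr 1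
    ext v
    simp only [jointSet, mem_ofPred_eq, mem_iUnion, mem_insert_iff, mem_singleton_iff, exists_prop]
    constructor
    · rintro (hv | hv)
      exacts [⟨v, hv, Or.inl rfl⟩, ⟨v - 1, hv, Or.inr (sub_add_cancel v 1).symm⟩]
    · rintro ⟨j, hj, rfl | rfl⟩
      exacts [Or.inl hj, Or.inr (by rwa [add_sub_cancel_right])]
  rw [h1, image_iUnion₂, ← Matroid.closure_biUnion_closure_eq_closure_biUnion]
  simp only [h.closure_pair]
  rw [Matroid.closure_biUnion_closure_eq_closure_biUnion]

theorem rk_biUnion [M₀.Finite] (J : Set (Fin r)) :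
    rk M (⋃ j ∈ J, L j) = (jointSet J).ncard := by
  rw [h.rk_eq (h.pairs.1.biUnion_subset J), ← h.rk_joints, rk, rk, ← Matroid.eRk_closure_eq,
    h.closure_biUnion, Matroid.eRk_closure_eq]

/-- The joints are independent, so closures of sets of joints intersect in the closure of the
intersection. An element of `L i` in this closure would lie in the span of a single joint, against
simplicity. -/
theorem notMem_closure {i : Fin r} {e : α} (he : e ∈ L i) {S : Set (Fin r)}
    (hS : i ∉ S ∨ i + 1 ∉ S) : Sum.inl e ∉ M₀.closure (Sum.inr '' S) := by
  intro hmem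
  have hmem2 : Sum.inl e ∈ M₀.closure (Sum.inr '' {i, i + 1}) := by
    rw [image_pair]
    exact h.subset_closure i ⟨e, he, rfl⟩
  have h1 : Sum.inl e ∈ M₀.closure (Sum.inr '' (S ∩ {i, i + 1})) := by
    rw [image_inter Sum.inr_injective, (Matroid.Indep.closure_inter_eq_inter_closure
      (by rw [← image_union]; exact h.indep_joints _))]
    exact ⟨hmem, hmem2⟩
  obtain ⟨v, hv⟩ : ∃ v, S ∩ {i, i + 1} ⊆ {v} := by
    rcases hS with hS | hS
    · refine ⟨i + 1, ?_⟩
      rintro x ⟨hx, rfl | rfl⟩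
      exacts [absurd hx hS, rfl]
    · refine ⟨i, ?_⟩
      rintro x ⟨hx, rfl | rfl⟩
      exacts [rfl, absurd hx hS]
  have h2 := M₀.closure_subset_closure (image_mono (f := Sum.inr) hv) h1
  rw [image_singleton] at h2
  have h3 := h.simple _ (h.mem_ground (h.pairs.1.subset i he)) _ (h.joint_mem_ground v)
  have h4 := h3.notMem_closure_sdiff_of_mem (mem_insert _ _)
  rw [insert_sdiff_self_of_notMem (by simp)] at h4
  exact h4 h2

theorem rk_insert [M₀.Finite] {J : Set (Fin r)} {i : Fin r} {e : α} (he : e ∈ L i)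
    (hJ : i ∉ jointSet J ∨ i + 1 ∉ jointSet J) :
    rk M (insert e (⋃ j ∈ J, L j)) = rk M (⋃ j ∈ J, L j) + 1 := by
  have heE := h.pairs.1.subset i he
  have hJE := h.pairs.1.biUnion_subset J
  rw [h.rk_eq (insert_subset heE hJE), h.rk_eq hJE, image_insert_eq,
    rk_insert_of_notMem_closure (h.mem_ground heE)]
  rw [h.closure_biUnion]
  exact h.notMem_closure he hJ

theorem rk_ground [M₀.Finite] : rk M M.E = r := by
  have h1 := h.rk_biUnion univ
  have h2 : jointSet (univ : Set (Fin r)) = univ := eq_univ_of_forall fun v ↦ Or.inl trivial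
  rw [biUnion_univ, h.pairs.1.2.2, h2, ncard_univ, Nat.card_eq_fintype_card,
    Fintype.card_fin] at h1
  exact h1

/-- The union spans three joints, so it has rank 3. After removing an element of one pair, the other
pair and the remaining element still have rank 3, because each of the two lines has a joint that the
other lacks; r ≥ 3 is needed for this. -/
theorem isCircuit [M.Finite] (i : Fin r) : M.IsCircuit (L i ∪ L (i + 1)) := by
  have := h.finite
  have hr := h.three_le
  have hne := Fin.add_one_ne_self hr
  have hne2 := Fin.add_one_add_one_ne_self hr
  have hpair : L i ∪ L (i + 1) = ⋃ j ∈ ({i, i + 1} : Set (Fin r)), L j := by rw [biUnion_pair]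
  have hsub : L i ∪ L (i + 1) ⊆ M.E := by rw [hpair]; exact h.pairs.1.biUnion_subset _
  have hjoint1 : ∀ a : Fin r, jointSet {a} = {a, a + 1} := fun a ↦ by
    ext v
    simp [jointSet, sub_eq_iff_eq_add]
  have hrk1 : ∀ a, rk M (L a) = 2 := fun a ↦ by
    have := h.rk_biUnion {a}
    rw [biUnion_singleton, hjoint1, ncard_pair (hne a).symm] at this
    exact this
  have hrkins : ∀ a b e, e ∈ L b → (b ∉ ({a, a + 1} : Set (Fin r)) ∨
      b + 1 ∉ ({a, a + 1} : Set (Fin r))) → rk M (insert e (L a)) = 3 := fun a b e he hb ↦ by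
    have := h.rk_insert (J := {a}) he (by rwa [hjoint1])
    rw [biUnion_singleton, hrk1] at this
    linarith
  have hrk : rk M (L i ∪ L (i + 1)) = 3 := by
    rw [hpair, h.rk_biUnion]
    have : jointSet {i, i + 1} = {i, i + 1, i + 1 + 1} := by
      ext v
      simp only [jointSet, mem_ofPred_eq, mem_insert_iff, mem_singleton_iff, sub_eq_iff_eq_add]
      tauto
    rw [this, ncard_eq_three.2
      ⟨i, i + 1, i + 1 + 1, (hne _).symm, (hne2 _).symm, (hne _).symm, rfl⟩]
    norm_num
  rw [isCircuit_iff_rk hsub, hrk, h.pairs.ncard_union (hne i).symm]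
  refine ⟨by norm_num, fun e he ↦ le_antisymm ?_ ?_⟩
  · have := rk_mono (M := M) (sdiff_subset : (L i ∪ L (i + 1)) \ {e} ⊆ _)
    rw [hrk] at this
    exact this
  · have key : ∀ a b, a ≠ b → L a ∪ L b = L i ∪ L (i + 1) → e ∈ L b →
        (b ∉ ({a, a + 1} : Set (Fin r)) ∨ b + 1 ∉ ({a, a + 1} : Set (Fin r))) →
        3 ≤ rk M ((L i ∪ L (i + 1)) \ {e}) := by
      intro a b hab hU heb hb
      obtain ⟨f, hf, hfe⟩ := exists_ne_of_one_lt_ncard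
        (show 1 < (L b).ncard by rw [h.pairs.2]; decide) e
      rw [← hrkins a b f hf hb]
      refine rk_mono (insert_subset ⟨hU ▸ Or.inr hf, hfe⟩ fun x hx ↦ ⟨hU ▸ Or.inl hx, ?_⟩)
      rintro rfl
      exact disjoint_left.1 (h.pairs.1.2.1 a b hab) hx heb
    rcases he with he | he
    · exact key (i + 1) i (hne i) (union_comm _ _) he
        (Or.inl (by simp [(hne i).symm, (hne2 i).symm]))
    · exact key i (i + 1) (hne i).symm rfl he (Or.inr (by simp [hne2 i, hne (i + 1)]))

theorem isCocircuit [M.Finite] (i : Fin r) : M.IsCocircuit (L i ∪ L (i + 1)) := by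
  have := h.finite
  have hr := h.three_le
  have hne := Fin.add_one_ne_self hr
  have hne2 := Fin.add_one_add_one_ne_self hr
  have hpair : L i ∪ L (i + 1) = ⋃ j ∈ ({i, i + 1} : Set (Fin r)), L j := by rw [biUnion_pair]
  have hsub : L i ∪ L (i + 1) ⊆ M.E := by rw [hpair]; exact h.pairs.1.biUnion_subset _
  -- The remaining pairs span every joint except the one shared by the two removed lines, so they
  -- span a hyperplane that contains no element of the removed pairs.
  have hV : jointSet ({i, i + 1} : Set (Fin r))ᶜ = {i + 1}ᶜ := by
    ext v
    simp only [jointSet, mem_ofPred_eq, mem_compl_iff, mem_insert_iff, mem_singleton_iff,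
      sub_eq_iff_eq_add]
    constructor
    · rintro hv rfl
      simp at hv
    · intro hv
      by_cases hvi : v = i
      · subst hvi
        exact Or.inr (by simp [(hne _).symm, (hne2 _).symm])
      · exact Or.inl (by simp [hv, hvi])
  have hrk : rk M (M.E \ (L i ∪ L (i + 1))) = r - 1 := by
    rw [hpair, h.pairs.1.diff_biUnion, h.rk_biUnion, hV]
    have := ncard_add_ncard_compl ({i + 1} : Set (Fin r))
    rw [ncard_singleton, Nat.card_eq_fintype_card, Fintype.card_fin] at this
    omega
  rw [isCocircuit_iff_rk hsub, hrk, h.rk_ground]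
  refine ⟨rfl, fun e he ↦ ?_⟩
  have key : ∀ b, e ∈ L b → (b ∉ ({i + 1}ᶜ : Set (Fin r)) ∨ b + 1 ∉ ({i + 1}ᶜ : Set (Fin r))) →
      rk M (insert e (M.E \ (L i ∪ L (i + 1)))) = r := by
    intro b hb hb'
    have h1 := h.rk_insert (J := ({i, i + 1} : Set (Fin r))ᶜ) hb (by rwa [hV])
    rw [← h.pairs.1.diff_biUnion, ← hpair, hrk] at h1
    linarith
  rcases he with he | he
  · exact key i he (Or.inr (by simp))
  · exact key (i + 1) he (Or.inl (by simp))

/-- Let e be the number of runs of J and S its shift by one. The union for J spans |J ∪ S| = |J| + e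
joints. The complementary union spans all joints outside S ∩ J, that is r - (|J| - e) of them. The
sum exceeds r by 2e. -/
theorem conn_biUnion [M₀.Finite] (J : Set (Fin r)) :
    conn M (⋃ j ∈ J, L j) = 2 * (runEnds J).ncard := by
  rw [conn, h.pairs.1.diff_biUnion, h.rk_biUnion, h.rk_biUnion, h.rk_ground]
  have h1 : (jointSet J).ncard = J.ncard + (runEnds J).ncard := by
    rw [← ncard_union_eq (disjoint_left.2 fun v hv hv' ↦ hv'.1 hv)]
    congr 1
    ext v
    simp only [jointSet, runEnds, mem_ofPred_eq, mem_union]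
    tauto
  let S : Set (Fin r) := {v | v - 1 ∈ J}
  have hS : S.ncard = J.ncard := by
    have : J = (fun v ↦ v - 1) '' S := by
      ext v
      simp only [S, mem_image, mem_ofPred_eq]
      exact ⟨fun hv ↦ ⟨v + 1, by rwa [add_sub_cancel_right], by rw [add_sub_cancel_right]⟩,
        by rintro ⟨x, hx, rfl⟩; exact hx⟩
    conv_rhs => rw [this]
    rw [ncard_image_of_injective _ sub_left_injective]
  have h2 : (jointSet Jᶜ).ncard + (S ∩ J).ncard = r := by
    have h3 := ncard_add_ncard_compl (S ∩ J)
    rw [Nat.card_eq_fintype_card, Fintype.card_fin] at h3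
    have h4 : (S ∩ J)ᶜ = jointSet Jᶜ := by
      ext v
      simp only [S, jointSet, mem_ofPred_eq, mem_compl_iff, mem_inter_iff]
      tauto
    rw [← h4]
    omega
  have h3 : (S ∩ J).ncard + (runEnds J).ncard = S.ncard := by
    rw [← ncard_inter_add_ncard_sdiff_eq_ncard S J]
    congr 2
    ext v
    simp only [S, runEnds, mem_ofPred_eq, mem_sdiff]
    tauto
  omega

theorem hasWindows [M.Finite] (hL : ListsPairs σ L) : HasWindows 4 M σ 1 :=
  hasWindows_four_of_listsPairs hL fun j ↦ ⟨h.isCircuit j, h.isCocircuit j⟩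

theorem isEvenTCyclicOrdering (hσ : IsCyclicOrdering σ M.E) (hL : ListsPairs σ L) :
    IsEvenTCyclicOrdering 4 M σ := by
  have := hσ.finite
  have hr := h.three_le
  exact ((h.hasWindows hL).isTCyclicOrdering hσ (by omega) (by omega)).2.2 (by decide)

theorem isDaisy (hσ : IsCyclicOrdering σ M.E) (hL : ListsPairs σ L) {m : ℕ} [NeZero m]
    {P : Fin m → Set α} (hP : IsEvenConcatenation 4 σ P) : IsDaisy 3 M P := by
  have := hσ.finite
  have := h.finite
  have hr := h.three_le
  refine ⟨isFlower_of_isEvenConcatenation (u := 1) hσ.2.1 hσ.2.2 rfl hr (h.hasWindows hL) hP,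
    fun I hI hI' ↦ ?_⟩
  obtain ⟨p, s, hp, h1, h2, h3⟩ := hP.exists_petal_maps hσ.2.1
  have h4 := h.conn_biUnion (p ⁻¹' I)
  rw [ncard_runEnds_preimage h1 h2 h3] at h4
  simp only [hL _] at h4
  rw [isConsecutive_iff_ncard_runEnds hI hI', ExactlySeparating, biUnion_petals hp, h4]
  omega

end IsSwirlExtension

theorem IsSwirl.exists_isSwirlExtension (h : IsSwirl r M L) :
    ∃ M₀, IsSwirlExtension M L M₀ := by
  obtain ⟨h1, h2, M₀, h3, h4, h5, h6, h7⟩ := h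
  exact ⟨M₀, h1, h2, h3, h4, h5, h6, h7⟩

end Swirl


/-! ### The standard ordering of `2 r` elements in `r` pairs -/

section StandardOrdering

variable {r : ℕ} [NeZero r]

/-- The ordering of `Fin (2 * r)` that starts at the subscript `1`. -/
def standardOrdering (r : ℕ) [NeZero r] (z : ZMod (2 * r)) : Fin (2 * r) :=
  ⟨(z - 1).val, ZMod.val_lt (z - 1)⟩

/-- The pairs `{2 j, 2 j + 1}`. -/
def standardPair (j : Fin r) : Set (Fin (2 * r)) := {x | (x : ℕ) / 2 = j}

theorem standardOrdering_isCyclicOrdering : IsCyclicOrdering (standardOrdering r) univ := by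
  have hr := NeZero.pos r
  have hinj : Function.Injective (standardOrdering r) := fun a b hab ↦ by
    have := ZMod.val_injective _ (congrArg Fin.val hab)
    exact sub_left_injective this
  refine ⟨by omega, hinj, Set.range_eq_univ.2 fun x ↦ ⟨((x : ℕ) : ZMod (2 * r)) + 1, ?_⟩⟩
  ext
  simp [standardOrdering, ZMod.val_natCast_of_lt x.2]

theorem val_standardOrdering_succ {b : ℕ} (hb : b < 2 * r) :
    (standardOrdering r ((b + 1 : ℕ) : ZMod (2 * r)) : ℕ) = b := by
  simp [standardOrdering, ZMod.val_natCast_of_lt hb]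

theorem standardOrdering_listsPairs : ListsPairs (standardOrdering r) standardPair := by
  intro j
  have hj := j.2
  ext x
  constructor
  · intro hx
    have hx : (x : ℕ) / 2 = j := hx
    refine ⟨x + 1, ⟨by omega, by omega⟩, ?_⟩
    ext
    exact val_standardOrdering_succ x.2
  · rintro ⟨y, ⟨hy1, hy2⟩, rfl⟩
    obtain ⟨b, rfl⟩ := Nat.exists_eq_add_of_le' (show 1 ≤ y by omega)
    change _ / 2 = _
    rw [val_standardOrdering_succ (by omega)]
    omega

theorem standardPair_isPairPartition : IsPairPartition (standardPair (r := r)) univ := by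
  have hr := NeZero.pos r
  have hcard : ∀ j : Fin r, (standardPair j).ncard = 2 := fun j ↦ by
    rw [standardOrdering_listsPairs j,
      ncard_window standardOrdering_isCyclicOrdering.2.1 (by omega)]
  refine ⟨⟨fun j ↦ nonempty_of_ncard_ne_zero (by rw [hcard]; decide), fun i j hij ↦ ?_, ?_⟩, hcard⟩
  · rw [disjoint_left]
    exact fun x hi hj ↦ hij (Fin.ext (hi.symm.trans hj))
  · exact eq_univ_of_forall fun x ↦ mem_iUnion.2 ⟨⟨(x : ℕ) / 2, by omega⟩, rfl⟩

end StandardOrdering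

/-! ### Parallel pairs -/

section ParallelPairs

/-- The pair that contains an element. -/
def pairIndex {r : ℕ} (x : Fin (2 * r)) : Fin r := ⟨(x : ℕ) / 2, by omega⟩

theorem standardPair_eq_preimage {r : ℕ} (j : Fin r) : standardPair j = pairIndex ⁻¹' {j} := by
  ext x
  exact (Fin.ext_iff (a := pairIndex x) (b := j)).symm

theorem pairIndex_surjective {r : ℕ} : Function.Surjective (pairIndex (r := r)) := fun j ↦
  ⟨⟨2 * j, by omega⟩, by ext; simp [pairIndex]⟩

variable {r : ℕ} [NeZero r]


/-- The direct sum of `r` parallel pairs. -/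
def parallelPairs (r : ℕ) [NeZero r] : Matroid (Fin (2 * r)) :=
  (Matroid.freeOn univ).comap pairIndex

theorem parallelPairs_ground : (parallelPairs r).E = univ := by
  simp [parallelPairs]

instance : (parallelPairs r).Finite := ⟨toFinite _⟩

theorem rk_parallelPairs (X : Set (Fin (2 * r))) :
    rk (parallelPairs r) X = (pairIndex '' X).ncard := by
  rw [rk, parallelPairs, Matroid.eRk_comap, Matroid.eRk_freeOn (subset_univ _)]
  rfl

theorem parallelPairs_hasWindows : HasWindows 2 (parallelPairs r) (standardOrdering r) 1 := by
  have key : ∀ j : Fin r, (parallelPairs r).IsCircuit (standardPair j) ∧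
      (parallelPairs r).IsCocircuit (standardPair j) := by
    intro j
    have hsub : standardPair j ⊆ (parallelPairs r).E := by
      rw [parallelPairs_ground]
      exact subset_univ _
    have h2 := standardPair_isPairPartition.2 j
    have hle : ∀ X ⊆ standardPair j, X.Nonempty → (pairIndex '' X).ncard = 1 := by
      intro X hX hne
      rw [ncard_eq_one]
      refine ⟨j, (subset_singleton_iff_eq.1 ?_).resolve_left (hne.image _).ne_empty⟩
      rw [image_subset_iff, ← standardPair_eq_preimage]
      exact hX
    constructor
    · rw [isCircuit_iff_rk hsub, rk_parallelPairs, h2,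
        hle _ subset_rfl (standardPair_isPairPartition.1.1 j)]
      refine ⟨by norm_num, fun e he ↦ ?_⟩
      obtain ⟨f, hf, hfe⟩ := exists_ne_of_one_lt_ncard (show 1 < (standardPair j).ncard by
        rw [h2]; decide) e
      rw [rk_parallelPairs, hle _ sdiff_subset ⟨f, hf, hfe⟩]
      norm_num
    · have hc : pairIndex '' ((parallelPairs r).E \ standardPair j) = {j}ᶜ := by
        rw [parallelPairs_ground, standardPair_eq_preimage, ← compl_eq_univ_sdiff,
          ← preimage_compl, image_preimage_eq _ pairIndex_surjective]
      rw [isCocircuit_iff_rk hsub]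
      simp only [rk_parallelPairs, image_insert_eq, hc]
      have hu : pairIndex '' (parallelPairs r).E = univ := by
        rw [parallelPairs_ground, image_univ_of_surjective pairIndex_surjective]
      rw [hu]
      refine ⟨?_, fun e he ↦ ?_⟩
      · have := ncard_add_ncard_compl ({j} : Set (Fin r))
        rw [ncard_singleton, ← ncard_univ] at this
        omega
      · rw [standardPair_eq_preimage] at he
        rw [show pairIndex e = j from he, insert_eq, union_compl_self]
  have key' : ∀ i, Even (i + 1) → (parallelPairs r).IsCircuit (window (standardOrdering r) i 2) ∧
      (parallelPairs r).IsCocircuit (window (standardOrdering r) i 2) := fun i hi ↦ by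
    obtain ⟨j, hj, -⟩ := exists_window_eq_pair (σ := standardOrdering r) (i := i)
      (by rw [Nat.odd_iff, Nat.even_iff] at *; omega)
    rw [hj, ← standardOrdering_listsPairs]
    exact key j
  exact ⟨fun i hi ↦ (key' i hi).1, fun i hi ↦ (key' i (by rw [Nat.even_iff] at *; omega)).2⟩

/-- Unions of petals are unions of components of a direct sum, so their connectivity is 0. -/
theorem parallelPairs_isAnemone {t m : ℕ} [NeZero m] {P : Fin m → Set (Fin (2 * r))}
    (hP : IsEvenConcatenation t (standardOrdering r) P) : IsAnemone 1 (parallelPairs r) P := by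
  have hσ := standardOrdering_isCyclicOrdering (r := r)
  obtain ⟨p, s, hp, -⟩ := hP.exists_petal_maps hσ.2.1
  have hpart : IsPartition P (parallelPairs r).E := by
    obtain ⟨k, hk, -⟩ := hP
    rw [parallelPairs_ground, ← hσ.2.2]
    exact hk.isPartition hσ.2.1 hσ.1
  refine isAnemone_of_forall hpart fun I _ _ ↦ ?_
  have h1 : (⋃ j ∈ p ⁻¹' I, standardPair j) = pairIndex ⁻¹' (p ⁻¹' I) := by
    ext x
    simp [standardPair_eq_preimage]
  simp only [standardOrdering_listsPairs _] at h1
  rw [ExactlySeparating, biUnion_petals hp, h1, conn, parallelPairs_ground, ← compl_eq_univ_sdiff,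
    ← preimage_compl]
  simp only [rk_parallelPairs, image_preimage_eq _ pairIndex_surjective,
    image_univ_of_surjective pairIndex_surjective]
  have := ncard_add_ncard_compl (p ⁻¹' I)
  rw [← ncard_univ] at this
  omega

theorem parallelPairs_isEvenTCyclicOrdering (hr : 3 ≤ r) :
    IsEvenTCyclicOrdering 2 (parallelPairs r) (standardOrdering r) :=
  (parallelPairs_hasWindows.isTCyclicOrdering
    (by rw [parallelPairs_ground]; exact standardOrdering_isCyclicOrdering) (by omega)
    (by omega)).2.2 even_two

end ParallelPairs

/-! ### Linear matroids -/

section Linear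

variable {ι K V : Type*} [Finite ι] [Field K] [AddCommGroup V] [Module K V] (v : ι → V)

theorem finrank_span_image_eq_ncard {I : Set ι} (hI : LinearIndepOn K v I) :
    Module.finrank K (Submodule.span K (v '' I)) = I.ncard := by
  have := Fintype.ofFinite I
  rw [image_eq_range, finrank_span_eq_card hI, ← Nat.card_eq_fintype_card]
  rfl

/-- The matroid of a finite family of vectors. -/
def linearMatroid (K : Type*) {V : Type*} [Field K] [AddCommGroup V] [Module K V] (v : ι → V) :
    Matroid ι :=
  (IndepMatroid.ofFinite (finite_univ (α := ι)) (LinearIndepOn K v)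
    (linearIndepOn_empty K v) (fun _ _ hJ hIJ ↦ hJ.mono hIJ)
    (fun I J hI hJ hlt ↦ by
      by_contra! hcon
      -- If no element of J enlarges I, the span of J lies in that of I, and comparing dimensions
      -- contradicts |I| < |J|.
      have hle : Submodule.span K (v '' J) ≤ Submodule.span K (v '' I) := by
        rw [Submodule.span_le]
        rintro _ ⟨e, he, rfl⟩
        by_cases heI : e ∈ I
        · exact Submodule.subset_span ⟨e, heI, rfl⟩
        · by_contra hsp
          exact hcon e he heI (hI.insert hsp)
      have : FiniteDimensional K (Submodule.span K (v '' I)) :=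
        FiniteDimensional.span_of_finite K (toFinite _)
      have h1 := Submodule.finrank_mono hle
      rw [finrank_span_image_eq_ncard v hI, finrank_span_image_eq_ncard v hJ] at h1
      omega)
    (fun _ _ ↦ subset_univ _)).matroid

theorem linearMatroid_ground : (linearMatroid K v).E = univ := rfl

theorem linearMatroid_indep {I : Set ι} : (linearMatroid K v).Indep I ↔ LinearIndepOn K v I :=
  Iff.rfl

theorem mem_closure_linearMatroid {I : Set ι} {e : ι} (hI : LinearIndepOn K v I)
    (he : v e ∈ Submodule.span K (v '' I)) : e ∈ (linearMatroid K v).closure I := by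
  rw [Matroid.Indep.mem_closure_iff' ((linearMatroid_indep v).2 hI)]
  refine ⟨trivial, fun h ↦ ?_⟩
  by_contra heI
  exact ((linearIndepOn_insert heI).1 ((linearMatroid_indep v).1 h)).2 he

end Linear

/-! ### A rational swirl -/

section RationalSwirl

variable {r : ℕ} [NeZero r]

/-- The vector `b_j + c b_{j+1}`. -/
def cycleVector (j : Fin r) (c : ℚ) : Fin r → ℚ := Pi.single j 1 + c • Pi.single (j + 1) 1

/-- The pairs `b_j + b_{j+1}`, `b_j + 2 b_{j+1}` and the joints `b_j`. -/
def swirlVector : Fin (2 * r) ⊕ Fin r → Fin r → ℚ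
  | Sum.inl x => cycleVector (pairIndex x) ((x : ℕ) % 2 + 1 : ℕ)
  | Sum.inr j => cycleVector j 0

/-- Allowing the coefficient 0 treats joints and pair elements alike: on one line, distinct
coefficients give independent vectors, and on different lines the coordinates j and k already
separate them. This is the simplicity of the swirl. -/
theorem cycleVector_pair (hr : 3 ≤ r) {j k : Fin r} {b c : ℚ} (h : j = k → b ≠ c) {x y : ℚ}
    (hxy : x • cycleVector j b + y • cycleVector k c = 0) : x = 0 ∧ y = 0 := by
  have hne := Fin.add_one_ne_self hr
  have hne2 := Fin.add_one_add_one_ne_self hr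
  have hev : ∀ i, x * ((if i = j then 1 else 0) + b * if i = j + 1 then 1 else 0) +
      y * ((if i = k then 1 else 0) + c * if i = k + 1 then 1 else 0) = 0 := fun i ↦ by
    have := congrFun hxy i
    simp only [cycleVector, Pi.add_apply, Pi.smul_apply, Pi.single_apply, smul_eq_mul,
      Pi.zero_apply] at this
    exact this
  by_cases hjk : j = k
  · subst hjk
    have h1 := hev j
    have h2 := hev (j + 1)
    simp only [(hne j).symm, hne j, if_true, if_false] at h1 h2
    have hbc := h rfl
    have h3 : x * (b - c) = 0 := by linear_combination h2 - c * h1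
    have hx := (mul_eq_zero.1 h3).resolve_right (sub_ne_zero.2 hbc)
    exact ⟨hx, by rw [hx] at h1; linarith⟩
  · have h1 := hev j
    have h2 := hev k
    by_cases h3 : j = k + 1
    · subst h3
      simp only [(hne2 k).symm, (hne (k + 1)).symm, hne k, (hne k).symm, if_true, if_false] at h1 h2
      have hy : y = 0 := by linarith
      exact ⟨by rw [hy] at h1; linarith, hy⟩
    · simp only [(hne j).symm, hjk, Ne.symm hjk, h3, if_true, if_false, (hne k).symm] at h1 h2
      have hx : x = 0 := by linarith
      exact ⟨hx, by rw [hx] at h2; linarith⟩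

theorem swirlVector_pair (hr : 3 ≤ r) {e f : Fin (2 * r) ⊕ Fin r} (hef : e ≠ f) :
    LinearIndepOn ℚ swirlVector {e, f} := by
  rw [LinearIndepOn.pair_iff _ hef]
  intro x y hxy
  rcases e with e | e <;> rcases f with f | f
  · refine cycleVector_pair hr (fun h heq ↦ hef ?_) hxy
    have h1 := congrArg Fin.val h
    have h2 : (e : ℕ) % 2 + 1 = (f : ℕ) % 2 + 1 := by exact_mod_cast heq
    simp only [pairIndex] at h1
    congr 1
    ext
    omega
  · exact cycleVector_pair hr (fun _ ↦ by positivity) hxy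
  · exact cycleVector_pair hr (fun _ ↦ Ne.symm (by positivity)) hxy
  · exact cycleVector_pair hr (fun h ↦ absurd (congrArg Sum.inr h) hef) hxy

theorem swirlVector_inr (j : Fin r) : swirlVector (Sum.inr j) = Pi.single j 1 := by
  simp [swirlVector, cycleVector]

theorem linearIndepOn_joints :
    LinearIndepOn ℚ (swirlVector (r := r)) (range Sum.inr) := by
  rw [linearIndepOn_range_iff Sum.inr_injective]
  have : swirlVector ∘ Sum.inr = Pi.basisFun ℚ (Fin r) := by
    ext j
    simp [swirlVector_inr]
  rw [this]
  exact (Pi.basisFun ℚ (Fin r)).linearIndependent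

theorem span_joints :
    Submodule.span ℚ (swirlVector '' range (Sum.inr : Fin r → Fin (2 * r) ⊕ Fin r)) = ⊤ := by
  rw [← (Pi.basisFun ℚ (Fin r)).span_eq, ← range_comp]
  congr 2
  ext j
  simp [swirlVector_inr]

/-- The swirl of the vectors `b_j + b_{j+1}` and `b_j + 2 b_{j+1}`. -/
def rationalSwirl (r : ℕ) [NeZero r] : Matroid (Fin (2 * r)) :=
  ((linearMatroid ℚ swirlVector).delete (range Sum.inr)).comap Sum.inl

theorem rationalSwirl_ground : (rationalSwirl r).E = univ := by
  ext x
  simp [rationalSwirl, linearMatroid_ground]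

theorem rationalSwirl_isSwirl (hr : 3 ≤ r) : IsSwirl r (rationalSwirl r) standardPair := by
  refine ⟨hr, by rw [rationalSwirl_ground]; exact standardPair_isPairPartition,
    linearMatroid ℚ swirlVector, ?_, fun e _ f _ ↦ ?_, ?_, fun i ↦ ?_, rfl⟩
  · rw [rationalSwirl_ground, linearMatroid_ground, image_univ, range_inl_union_range_inr]
  · rw [linearMatroid_indep]
    by_cases hef : e = f
    · subst hef
      obtain ⟨g, hg⟩ : ∃ g, g ≠ e := by
        by_cases he : e = Sum.inr 0
        · exact ⟨Sum.inl ⟨0, by omega⟩, by rw [he]; simp⟩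
        · exact ⟨Sum.inr 0, Ne.symm he⟩
      exact (swirlVector_pair hr hg).mono (by simp)
    · exact swirlVector_pair hr hef
  · refine Matroid.Indep.isBase_of_forall_insert ((linearMatroid_indep _).2 linearIndepOn_joints)
      fun e he hind ↦ ?_
    refine ((linearIndepOn_insert he.2).1 ((linearMatroid_indep _).1 hind)).2 ?_
    rw [span_joints]
    trivial
  · rintro _ ⟨x, hx, rfl⟩
    refine mem_closure_linearMatroid _ (linearIndepOn_joints.mono ?_) ?_
    · exact pair_subset (mem_range_self _) (mem_range_self _)
    · have hxi : pairIndex x = i := Fin.ext hx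
      rw [image_pair, swirlVector_inr, swirlVector_inr, swirlVector, hxi, cycleVector]
      exact add_mem (Submodule.subset_span (mem_insert _ _))
        (Submodule.smul_mem _ _ (Submodule.subset_span (mem_insert_of_mem _ rfl)))

end RationalSwirl

/-! ### Iterated truncation and lift of spikes and swirls -/

section Main

variable {α : Type*} {M : Matroid α} {r : ℕ} {L : Fin r → Set α} {σ : ZMod (2 * r) → α}

theorem IsSpike.iterate_truncLift (h : IsSpike r M L) (hσ : IsCyclicOrdering σ M.E)
    (hL : ListsPairs σ L) (k : ℕ) (hk : 2 * k + 3 ≤ r) :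
    IsEvenTCyclicOrdering (2 * k + 4) (truncLift^[k] M) σ ∧
      ∀ (m : ℕ) [NeZero m] (P : Fin m → Set α),
        IsEvenConcatenation (2 * k + 4) σ P → IsAnemone (2 * k + 3) (truncLift^[k] M) P := by
  obtain ⟨h1, h2, -⟩ := CyclicMatroid.iterate_truncLift (t := 4) (by omega) (by decide)
    (h.isEvenTCyclicOrdering hσ hL) k (by omega)
  rw [add_comm] at h1 h2
  exact ⟨h1, h2 fun m _ P hP ↦ h.isAnemone hσ hL hP⟩

theorem IsSwirl.iterate_truncLift [NeZero r] (h : IsSwirl r M L) (hσ : IsCyclicOrdering σ M.E)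
    (hL : ListsPairs σ L) (k : ℕ) (hk : 2 * k + 3 ≤ r) :
    IsEvenTCyclicOrdering (2 * k + 4) (truncLift^[k] M) σ ∧
      ∀ (m : ℕ) [NeZero m] (P : Fin m → Set α),
        IsEvenConcatenation (2 * k + 4) σ P → IsDaisy (2 * k + 3) (truncLift^[k] M) P := by
  obtain ⟨M₀, h⟩ := h.exists_isSwirlExtension
  obtain ⟨h1, -, h2⟩ := CyclicMatroid.iterate_truncLift (t := 4) (by omega) (by decide)
    (h.isEvenTCyclicOrdering hσ hL) k (by omega)
  rw [add_comm] at h1 h2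
  exact ⟨h1, h2 fun m _ P hP ↦ h.isDaisy hσ hL hP⟩

/-- Starting at t = 2 costs one more application of the construction than starting from a spike at t
= 4, with the same bound on r. -/
theorem parallelPairs_iterate_truncLift [NeZero r] (k : ℕ) (hk : 2 * k + 3 ≤ r) :
    IsEvenTCyclicOrdering (2 * k + 4) (truncLift^[k + 1] (parallelPairs r)) (standardOrdering r) ∧
      ∀ (m : ℕ) [NeZero m] (P : Fin m → Set (Fin (2 * r))),
        IsEvenConcatenation (2 * k + 4) (standardOrdering r) P →
          IsAnemone (2 * k + 3) (truncLift^[k + 1] (parallelPairs r)) P := by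
  obtain ⟨h1, h2, -⟩ := CyclicMatroid.iterate_truncLift (t := 2) le_rfl even_two
    (parallelPairs_isEvenTCyclicOrdering (r := r) (by omega)) (k + 1) (by omega)
  rw [show 2 + 2 * (k + 1) = 2 * k + 4 by ring] at h1 h2
  exact ⟨h1, h2 fun m _ P hP ↦ parallelPairs_isAnemone hP⟩

end Main

end CyclicMatroid

/-! ### The theorem -/

theorem mainTheorem4 {α : Type*} :
    -- the construction turns `t`-cyclic orderings into `(t+2)`-cyclic orderings
    (∀ (t n : ℕ) (M : Matroid α) (σ : ZMod n → α), 2 ≤ t → 2 * t + 2 ≤ n →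
      IsTCyclicOrdering t M σ →
        (truncLift M).E = M.E ∧
        IsTCyclicOrdering (t + 2) (truncLift M) σ ∧
        (IsOddTCyclicOrdering t M σ → IsOddTCyclicOrdering (t + 2) (truncLift M) σ) ∧
        (IsEvenTCyclicOrdering t M σ → IsEvenTCyclicOrdering (t + 2) (truncLift M) σ)) ∧
    -- petal ranks and flowers under the construction
    (∀ (t n : ℕ) (M : Matroid α) (σ : ZMod n → α), 2 ≤ t → Even t → 2 * t + 2 ≤ n →
      IsTCyclicOrdering t M σ →
        ∀ (m : ℕ) [NeZero m] (P : Fin m → Set α),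
          IsEvenConcatenation t σ P → (∀ i, t ≤ (P i).ncard) →
            IsFlower (t - 1) M P ∧ IsFlower (t + 1) (truncLift M) P ∧
            (4 ≤ m → ∀ i j, rk (truncLift M) (P i) = rk M (P i) + 1 ∧
              rk (truncLift M) (P i ∪ P j) = rk M (P i ∪ P j) + 1) ∧
            (IsAnemone (t - 1) M P → IsAnemone (t + 1) (truncLift M) P) ∧
            (IsDaisy (t - 1) M P → IsDaisy (t + 1) (truncLift M) P)) ∧
    -- iterating the construction, starting from a spike
    (∀ (r : ℕ) (M : Matroid α) (L : Fin r → Set α) (σ : ZMod (2 * r) → α),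
      IsSpike r M L → IsCyclicOrdering σ M.E →
      (∃ π : Equiv.Perm (Fin r), ListsPairs σ (fun i => L (π i))) →
        ∀ k : ℕ, 2 * k + 3 ≤ r →
          IsEvenTCyclicOrdering (2 * k + 4) (truncLift^[k] M) σ ∧
          ∀ (m : ℕ) [NeZero m] (P : Fin m → Set α),
            IsEvenConcatenation (2 * k + 4) σ P → IsAnemone (2 * k + 3) (truncLift^[k] M) P) ∧
    -- iterating the construction, starting from a swirl
    (∀ (r : ℕ) [NeZero r] (M : Matroid α) (L : Fin r → Set α) (σ : ZMod (2 * r) → α),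
      IsSwirl r M L → IsCyclicOrdering σ M.E → ListsPairs σ L →
        ∀ k : ℕ, 2 * k + 3 ≤ r →
          IsEvenTCyclicOrdering (2 * k + 4) (truncLift^[k] M) σ ∧
          ∀ (m : ℕ) [NeZero m] (P : Fin m → Set α),
            IsEvenConcatenation (2 * k + 4) σ P → IsDaisy (2 * k + 3) (truncLift^[k] M) P) ∧
    -- existence, for every even `t ≥ 4` and on every possible number `2 r` of elements
    (∀ t r : ℕ, 4 ≤ t → Even t → t - 1 ≤ r →
      (∃ (M : Matroid (Fin (2 * r))) (σ : ZMod (2 * r) → Fin (2 * r)),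
        IsEvenTCyclicOrdering t M σ ∧
        ∀ (m : ℕ) [NeZero m] (P : Fin m → Set (Fin (2 * r))),
          IsEvenConcatenation t σ P → IsAnemone (t - 1) M P) ∧
      (∃ (M : Matroid (Fin (2 * r))) (σ : ZMod (2 * r) → Fin (2 * r)),
        IsEvenTCyclicOrdering t M σ ∧
        ∀ (m : ℕ) [NeZero m] (P : Fin m → Set (Fin (2 * r))),
          IsEvenConcatenation t σ P → IsDaisy (t - 1) M P)) := by
  refine ⟨fun t n M σ ht hn h ↦ ⟨truncLift_ground M, isTCyclicOrdering_truncLift h ht hn⟩,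
    fun t n M σ ht hte hn h m _ P hP hPt ↦ flower_truncLift ht hte hn h hP hPt,
    fun r M L σ h hσ ⟨π, hL⟩ k hk ↦ (h.comp_perm π).iterate_truncLift hσ hL k hk,
    fun r _ M L σ h hσ hL k hk ↦ h.iterate_truncLift hσ hL k hk, fun t r ht hte hr ↦ ?_⟩
  obtain ⟨s, rfl⟩ := hte.two_dvd
  -- With t = 2k + 4, the condition t - 1 ≤ r is exactly the bound 2k + 3 ≤ r of the iteration.
  obtain ⟨k, rfl⟩ := Nat.exists_eq_add_of_le' (show 2 ≤ s by omega)
  have : NeZero r := ⟨by omega⟩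
  have hk : 2 * k + 3 ≤ r := by omega
  rw [show 2 * (k + 2) = 2 * k + 4 by ring]
  refine ⟨⟨_, _, parallelPairs_iterate_truncLift k hk⟩,
    ⟨truncLift^[k] (rationalSwirl r), standardOrdering r,
      (rationalSwirl_isSwirl (by omega)).iterate_truncLift ?_ standardOrdering_listsPairs k hk⟩⟩
  rw [rationalSwirl_ground]
  exact standardOrdering_isCyclicOrdering
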